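/- Let $p\ge 3$ and $q\ge 2$ be primes with $p\neq q$. Let $\mathcal X$ be a cyclic $p$-gonal compact Riemann surface of genus $g\ge 2$: there is a conformal automorphism $\tau$ of $\mathcal X$ of order $p$ such that $\mathcal X/\langle\tau\rangle$ has genus $0$. Let $r$ be the number of fixed points of $\tau$, so that $r\ge 3$ and $g=(p-1)(r-2)/2$. By uniformization, $\mathcal X=\mathbb H/\Gamma$ and $\mathcal X/\langle\tau\rangle=\mathbb H/\Delta$, where $$\Delta=\langle x_1,\dots,x_r\mid x_1^p=\dots=x_r^p=x_1x_2\cdots x_r=1\rangle$$ is a Fuchsian group of signature $(0;p,\dots,p)$ and $\Gamma\lhd\Delta$ is a normal subgroup of index $p$ acting freely on $\mathbb H$ (equivalently, containing no $x_i$). Let $\Gamma_q$ be the subgroup of $\Gamma$ generated by its derived subgroup and all $q$-th powers of its elements, so that $\widetilde{\mathcal X}=\mathbb H/\Gamma_q$ is the $q$-homology cover of $\mathcal X$. Put $\widetilde N=\Gamma/\Gamma_q\cong H_1(\mathcal X;\mathbb Z/q)$ and $\widetilde G=\Delta/\Gamma_q$, the group of all lifts to $\widetilde{\mathcal X}$ of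 the powers of $\tau$; $\widetilde N$ is normal in $\widetilde G$. For a linear character $V:\widetilde N\to\mathbb C^{\times}$ write $\widetilde V=\mathrm{Ind}_{\widetilde N}^{\widetilde G}V$. Let $w_q=e^{2\pi i/q}$, and let $\widetilde V^{\sigma}$ denote the Galois conjugate of $\widetilde V$ by $\sigma\in\mathrm{Gal}(\mathbb Q(w_q)/\mathbb Q)$, obtained by writing $\widetilde V$ with matrices over $\mathbb Q(w_q)$ and applying $\sigma$ to the entries. 1. (Complex irreducible representations.) There are exactly $p$ linear characters $\chi_0=1,\chi_1,\dots,\chi_{p-1}$ of $\widetilde G$ that are trivial on $\widetilde N$. The number $m=\dfrac{q^{(p-1)(r-2)}-1}{p}$ is an integer and is the number of orbits of $\widetilde G$, acting by conjugation, on the non-trivial linear characters of $\widetilde N$. If $V_1,\dots,V_m$ is any system of representatives of these orbits, then $\chi_0,\dots,\chi_{p-1}$ (of degree $1$) together with $\widetilde V_1,\dots,\widetilde V_m$ (of degree $p$) is a complete list, without repetitions up to isomorphism, of the complex irreducible representations of $\widetilde G$. 2. (Rational irreducible representations.) Assume moreover that $\gcd(p,q-1)=1$. The number $t=\dfrac{q^{(p-1)(r-2)}-1}{p(q-1)}$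 is an integer and is the number of orbits of $\widetilde G$, acting by conjugation, on the maximal subgroups of $\widetilde N$. Let $\widetilde L_1,\dots,\widetilde L_t$ be any system of representatives of these orbits. Each $\widetilde L_j$ is the kernel of some linear character of $\widetilde N$. For any choice of linear characters $V_j$ of $\widetilde N$ with $\ker V_j=\widetilde L_j$ $(1\le j\le t)$ there are rational representations $U$, of degree $p-1$, and $U_1,\dots,U_t$, of degree $p(q-1)$, of $\widetilde G$ with $$\mathbb C\otimes_{\mathbb Q}U\cong\chi_1\oplus\dots\oplus\chi_{p-1},\qquad \mathbb C\otimes_{\mathbb Q}U_j\cong\bigoplus_{\sigma\in\mathrm{Gal}(\mathbb Q(w_q)/\mathbb Q)}\widetilde V_j^{\,\sigma},$$ and $\chi_0,U,U_1,\dots,U_t$ is a complete list, without repetitions up to isomorphism, of the rational irreducible representations of $\widetilde G$. -/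

import Mathlib

open scoped DirectSum

noncomputable section

/-! ### The groups -/

namespace PGonal

/-- The relators `x_1 ^ p, …, x_r ^ p` and `x_1 x_2 ⋯ x_r`. -/
def relators (p r : ℕ) : Set (FreeGroup (Fin r)) :=
  (Set.range fun i : Fin r => FreeGroup.of i ^ p) ∪ {(List.ofFn fun i : Fin r => FreeGroup.of i).prod}

/-- The Fuchsian group `Δ` of signature `(0; p, …, p)` (with `r` periods),
`Δ = ⟨x_1, …, x_r ∣ x_1 ^ p = ⋯ = x_r ^ p = x_1 ⋯ x_r = 1⟩`, i.e. the orbifold fundamental group of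
`X / ⟨τ⟩ = ℍ / Δ`, a sphere with `r` cone points of order `p`. -/
abbrev FuchsianGroup (p r : ℕ) : Type :=
  PresentedGroup (relators p r)

/-- The canonical elliptic generator `x_i` of `Δ`. -/
def ellipticGen (p r : ℕ) (i : Fin r) : FuchsianGroup p r :=
  PresentedGroup.of i

/-- `IsSurfaceKernel p r Γ`: the (normal) subgroup `Γ` of `Δ` has index `p` and contains no
canonical elliptic generator. As the elements of finite order of `Δ` are the conjugates of
powers of the `x_i`, which have prime order `p`, this says that `Γ` acts freely on `ℍ`, i.e. that
`Γ` is the fundamental group of a compact Riemann surface `X = ℍ / Γ`, that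
`⟨τ⟩ = Δ / Γ` is cyclic of order `p`, and that `X → X / ⟨τ⟩ = ℍ / Δ` is a cyclic `p`-gonal cover
for which `τ` has exactly `r` fixed points. -/
structure IsSurfaceKernel (p r : ℕ) (Γ : Subgroup (FuchsianGroup p r)) [Γ.Normal] :
    Prop where
  index_eq : Γ.index = p
  gen_notMem : ∀ i : Fin r, ellipticGen p r i ∉ Γ

section HomologyCover

variable {Δ : Type} [Group Δ]

/-- `Γ_q`, the subgroup of `Γ` generated by the derived subgroup `Γ'` and all `q`-th powers of
elements of `Γ`; the surface `ℍ / Γ_q` is the `q`-homology cover of `ℍ / Γ`. -/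
def homologyKernel (Γ : Subgroup Δ) (q : ℕ) : Subgroup Δ :=
  ⁅Γ, Γ⁆ ⊔ Subgroup.closure ((fun γ : Δ => γ ^ q) '' (Γ : Set Δ))

instance homologyKernel_normal (Γ : Subgroup Δ) [hΓ : Γ.Normal] (q : ℕ) :
    (homologyKernel Γ q).Normal := by
  have h : (Subgroup.closure ((fun γ : Δ => γ ^ q) '' (Γ : Set Δ))).Normal := by
    refine ⟨fun n hn g => ?_⟩
    induction hn using Subgroup.closure_induction with
    | mem x hx =>
      obtain ⟨γ, hγ, rfl⟩ := hx
      refine Subgroup.subset_closure ⟨g * γ * g⁻¹, hΓ.conj_mem γ hγ g, ?_⟩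
      simp [conj_pow]
    | one => simp
    | mul x y _ _ hx hy =>
      have e : g * (x * y) * g⁻¹ = (g * x * g⁻¹) * (g * y * g⁻¹) := by group
      rw [e]
      exact mul_mem hx hy
    | inv x _ hx =>
      have e : g * x⁻¹ * g⁻¹ = (g * x * g⁻¹)⁻¹ := by group
      rw [e]
      exact inv_mem hx
  unfold homologyKernel
  infer_instance

/-- `G̃ = Δ / Γ_q`, the group of all lifts to the `q`-homology cover `X̃ = ℍ / Γ_q` of the
powers of `τ`, i.e. the deck group of `X̃ → X → X / ⟨τ⟩`. -/
abbrev LiftGroup (Γ : Subgroup Δ) [Γ.Normal] (q : ℕ) : Type :=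
  Δ ⧸ homologyKernel Γ q

/-- `Ñ = Γ / Γ_q ≅ H₁(X; ℤ/q)`, the `q`-homology group, as a subgroup of `G̃`. -/
def homologyGroup (Γ : Subgroup Δ) [Γ.Normal] (q : ℕ) : Subgroup (LiftGroup Γ q) :=
  Γ.map (QuotientGroup.mk' (homologyKernel Γ q))

instance homologyGroup_normal (Γ : Subgroup Δ) [hΓ : Γ.Normal] (q : ℕ) :
    (homologyGroup Γ q).Normal :=
  hΓ.map _ (QuotientGroup.mk'_surjective _)

end HomologyCover

/-! ### Representations -/

section Representations

variable {G : Type} [Group G]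

/-- The one-dimensional representation `g ↦ χ g` afforded by a linear character. -/
def charRep {k : Type} [Field k] (χ : G →* kˣ) : Representation k G k :=
  (Module.toModuleEnd k (S := k) k).toMonoidHom.comp ((Units.coeHom k).comp χ)

/-- The complex representation of `G` induced from a linear character of a subgroup `N`. -/
def indChar {N : Subgroup G} (V : N →* ℂˣ) : Rep.{0} ℂ G :=
  Rep.of (Representation.ind N.subtype (charRep V))

/-- The complexification `ℂ ⊗ W` of a rational representation. -/
def complexify {W : Type} [AddCommGroup W] [Module ℚ W] (ρ : Representation ℚ G W) :
    Representation ℂ G (TensorProduct ℚ ℂ W) :=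
  (Module.End.baseChangeHom ℚ ℂ W).toMonoidHom.comp ρ

/-- The representation on column vectors given by invertible matrices. -/
def matrixRep {k : Type} [Field k] {n : ℕ} (A : G →* GL (Fin n) k) :
    Representation k G (Fin n → k) :=
  (Matrix.toLinAlgEquiv' (R := k) (n := Fin n)).toMonoidHom.comp
    ((Units.coeHom (Matrix (Fin n) (Fin n) k)).comp A)

/-- The field `ℚ(w_q)`, `w_q = exp (2πi/q)`, as a subfield of `ℂ`. -/
def cyclotomicSubfield (q : ℕ) : IntermediateField ℚ ℂ :=
  IntermediateField.adjoin ℚ {Complex.exp (2 * Real.pi * Complex.I / q)}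

/-- For a subfield `K` of `ℂ` and `σ ∈ Gal(K/ℚ)`: the complex representation `ρ'` is the Galois
conjugate `ρ^σ` of `ρ`. That is, `ρ` can be written by matrices with entries in `K` in such a way
that applying `σ` to all entries gives `ρ'`. -/
def IsGaloisConj {K : IntermediateField ℚ ℂ} (σ : K ≃ₐ[ℚ] K) (ρ ρ' : Rep.{0} ℂ G) : Prop :=
  ∃ (n : ℕ) (A : G →* GL (Fin n) K),
    Nonempty (ρ.ρ.Equiv
      (matrixRep ((Matrix.GeneralLinearGroup.map (algebraMap K ℂ)).comp A))) ∧
    Nonempty (ρ'.ρ.Equiv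
      (matrixRep ((Matrix.GeneralLinearGroup.map
        ((algebraMap K ℂ).comp (σ : K →+* K))).comp A)))

/-- The family `X` is a complete list, without repetitions up to equivalence, of the irreducible
representations of `G` over `k`. -/
structure IsCompleteIrrepList {k : Type} [Field k] {ι : Type} (X : ι → Rep.{0} k G) : Prop where
  irreducible : ∀ i, (X i).ρ.IsIrreducible
  pairwise_inequivalent : ∀ i j, Nonempty ((X i).ρ.Equiv (X j).ρ) → i = j
  exhaustive : ∀ (W : Type) [AddCommGroup W] [Module k W] (ρ : Representation k G W),
    ρ.IsIrreducible → ∃ i, Nonempty (ρ.Equiv (X i).ρ)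

/-- `V` is a system of representatives of the orbits of `G`, acting by conjugation, on the
non-trivial linear characters of the normal subgroup `N`. -/
def IsCharOrbitReps {N : Subgroup G} [N.Normal] {ι : Type} (V : ι → (N →* ℂˣ)) : Prop :=
  (∀ j, V j ≠ 1) ∧
    ∀ W : N →* ℂˣ, W ≠ 1 → ∃! j, ∃ g : G, ∀ n : N, W n = V j (MulAut.conjNormal g⁻¹ n)

/-- `L` is a system of representatives of the orbits of `G`, acting by conjugation, on the
maximal subgroups of the normal subgroup `N`. -/
def IsMaximalOrbitReps {N : Subgroup G} [N.Normal] {ι : Type} (L : ι → Subgroup N) : Prop :=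
  (∀ j, IsCoatom (L j)) ∧
    ∀ M : Subgroup N, IsCoatom M →
      ∃! j, ∃ g : G, M = (L j).map (MulAut.conjNormal g : MulAut N).toMonoidHom

end Representations

end PGonal

end

/-! Put N = Γ/Γ_q, abelian of exponent q, and G = Δ/Γ_q, so that G/N has prime order p ≠ q.
Everything rests on the size of the dual of N and on the freeness of the action of G/N on the
non-trivial characters.

Size. Let s = r - 2 and write x_j = n_j x_0^{a_j} with n_j in N for 1 ≤ j ≤ s; the product relation
gives the last generator. The n_j generate N as a normal subgroup of G, and (n_j⁻¹ x_j)^p = 1 says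
that the p conjugates of n_j by powers of x_j have product 1. A character is thus determined by
(p-1)s values in μ_q (`evalConj_injective`). All values occur: in the wreath product of μ_q with
Δ/Γ, an element with non-trivial image in Δ/Γ and coordinates of product 1 has p-th power 1, so the
free choices define a homomorphism on Δ, and a coordinate of its restriction to Γ is the character
sought (`evalConj_surjective`).

Freeness. A character V fixed by an element outside N is G-invariant; then (n_j x_0^{a_j})^p = 1
gives V(n_j)^p = 1, and V(n_j)^q = 1, so V = 1 (`mem_of_conjHom_eq`). Hence all orbits of
non-trivial characters have p elements, which gives m, and by Mackey and Clifford they correspond to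
the irreducible representations of degree p (`isCompleteIrrepList_complex`).

Rationally, characters with equal kernel are Galois conjugate. If gcd(p, q-1) = 1, an element fixing
ker V raises V to a power a with a^p = 1 mod q, so a = 1: the action on maximal subgroups is free
too (`mem_of_ker_conjHom_eq`). Write Ind V with matrices over K = ℚ(w_q) and restrict scalars to ℚ.
The result is irreducible (`isIrreducible_ratRep`), since averaging over the kernel of a conjugate
of V is a rational operator isolating one K-line, on which N acts through all q-th roots of unity;
its complexification is the sum of the Galois conjugates (`complexify_ratRep_equiv`). The same
construction over ℚ(w_p), with G in place of N, gives U. Completeness descends from ℂ, because a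
non-zero intertwiner of complexifications has a non-zero rational coordinate
(`nonempty_equiv_of_complexify`). -/

noncomputable section

namespace PGonal

/-! ### Conjugation of characters of a normal subgroup of prime index. -/

section Conjugation

variable {G : Type} [Group G] {N : Subgroup G} [N.Normal]

/-- The conjugate `n ↦ V (g⁻¹ n g)` of a homomorphism `V` on a normal subgroup. -/
def conjHom {M : Type} [Monoid M] (g : G) (V : N →* M) : N →* M :=
  V.comp (MulAut.conjNormal g⁻¹ : MulAut N).toMonoidHom

lemma conjHom_apply {M : Type} [Monoid M] (g : G) (V : N →* M) (n : N) :
    conjHom g V n = V (MulAut.conjNormal g⁻¹ n) := rfl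

lemma conjHom_one {M : Type} [Monoid M] (V : N →* M) : conjHom (1 : G) V = V := by
  ext n; simp [conjHom_apply]

lemma conjHom_mul {M : Type} [Monoid M] (g h : G) (V : N →* M) :
    conjHom (g * h) V = conjHom g (conjHom h V) := by
  ext n; simp [conjHom_apply]

lemma conjHom_one_right {M : Type} [Monoid M] (g : G) : conjHom g (1 : N →* M) = 1 := by
  ext n; simp [conjHom_apply]

lemma conjHom_eq_one_iff {M : Type} [Monoid M] {g : G} {V : N →* M} :
    conjHom g V = 1 ↔ V = 1 := by
  refine ⟨fun h => ?_, fun h => by rw [h, conjHom_one_right]⟩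
  have := congrArg (conjHom g⁻¹) h
  rwa [← conjHom_mul, inv_mul_cancel, conjHom_one, conjHom_one_right] at this

lemma conjHom_of_mem {M : Type} [Monoid M] (hc : ∀ a b : N, a * b = b * a) {g : G} (hg : g ∈ N)
    (V : N →* M) : conjHom g V = V := by
  ext n
  rw [conjHom_apply]
  congr 1
  have := hc (⟨g, hg⟩⁻¹ * n) ⟨g, hg⟩
  ext
  simpa [mul_assoc] using congrArg (Subtype.val) this

/-- `(n b) ^ k = m b ^ k`, where `m` is the product of the conjugates of `n` by the `b ^ i`. -/
lemma exists_mul_pow_eq {A : Type} [CommGroup A] (U : N →* A) (n : N) (b : G) (k : ℕ) :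
    ∃ m : N, ((n : G) * b) ^ k = m * b ^ k ∧
      U m = ∏ i ∈ Finset.range k, U (MulAut.conjNormal (b ^ i) n) := by
  induction k with
  | zero => exact ⟨1, by simp, by simp⟩
  | succ k ih =>
    obtain ⟨m, h1, h2⟩ := ih
    refine ⟨m * MulAut.conjNormal (b ^ k) n, ?_, ?_⟩
    · rw [pow_succ, h1]
      simp only [Subgroup.coe_mul, MulAut.conjNormal_apply]
      group
    · rw [map_mul, h2, Finset.prod_range_succ]

lemma exists_eq_mul_pow_of_notMem {p : ℕ} (hp : p.Prime) (hN : N.index = p) {g : G} (hg : g ∉ N)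
    (h : G) : ∃ (a : ℕ) (n : N), h = n * g ^ a := by
  have := Fact.mk hp
  have hne : (g : G ⧸ N) ≠ 1 := by rwa [Ne, QuotientGroup.eq_one_iff]
  obtain ⟨a, ha⟩ := mem_powers_of_prime_card (G := G ⧸ N) (p := p) hN (g' := (h : G ⧸ N)) hne
  refine ⟨a, ⟨h * (g ^ a)⁻¹, ?_⟩, by simp⟩
  rw [← QuotientGroup.eq_one_iff]
  have ha' : (g : G ⧸ N) ^ a = h := ha
  simp [ha']

lemma pow_mem_iff_of_notMem {p : ℕ} (hp : p.Prime) (hN : N.index = p) {g : G} (hg : g ∉ N)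
    (a : ℕ) : g ^ a ∈ N ↔ p ∣ a := by
  have hne : (g : G ⧸ N) ≠ 1 := by rwa [Ne, QuotientGroup.eq_one_iff]
  have h1 : orderOf (g : G ⧸ N) = p := by
    have : orderOf (g : G ⧸ N) ∣ p := by
      have := orderOf_dvd_natCard (g : G ⧸ N)
      rwa [← Subgroup.index_eq_card, hN] at this
    rcases (Nat.dvd_prime hp).1 this with h | h
    · exact absurd (orderOf_eq_one_iff.1 h) hne
    · exact h
  rw [← QuotientGroup.eq_one_iff, QuotientGroup.mk_pow, ← orderOf_dvd_iff_pow_eq_one, h1]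

end Conjugation

/-- A normal subgroup `N` of prime index `p`, abelian of exponent `q`, together with a system of
generators of order `p` outside of `N` with product `1`. -/
structure IsEllipticSystem {G : Type} [Group G] (N : Subgroup G) (p q s : ℕ)
    (x : Fin (s + 2) → G) : Prop where
  prime_p : p.Prime
  prime_q : q.Prime
  ne : p ≠ q
  pow_eq : ∀ i, x i ^ p = 1
  prod_eq : (List.ofFn x).prod = 1
  closure_eq : Subgroup.closure (Set.range x) = ⊤
  notMem : ∀ i, x i ∉ N
  index_eq : N.index = p
  comm : ∀ a b : N, a * b = b * a
  pow_q : ∀ a : N, a ^ q = 1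

/-! ### Generation of N, freeness of the action, and the upper bound for the dual. -/

namespace IsEllipticSystem

variable {G : Type} [Group G] {N : Subgroup G} [N.Normal] {p q s : ℕ} {x : Fin (s + 2) → G}

/-- The class of `x 0` generates G/N. The index `j.succ.castSucc` runs over all generators except
the first and the last, which the product relation makes redundant. -/
lemma exists_exponent (H : IsEllipticSystem N p q s x) :
    ∃ (a : Fin s → ℕ) (n : Fin s → N), ∀ j, x j.succ.castSucc = n j * x 0 ^ a j := by
  choose a n h using fun j : Fin s =>
    exists_eq_mul_pow_of_notMem H.prime_p H.index_eq (H.notMem 0) (x j.succ.castSucc)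
  exact ⟨a, n, h⟩

/-- The `n j` generate N as a normal subgroup. Modulo K every generator is a power of `x 0`, the
last one by the product relation. So an element of N is congruent to some `x 0 ^ e`, which lies in
N; this forces p ∣ e and `x 0 ^ e = 1`. -/
lemma le_of_forall_mem (H : IsEllipticSystem N p q s x) {a : Fin s → ℕ} {n : Fin s → N}
    (h : ∀ j, x j.succ.castSucc = n j * x 0 ^ a j) (K : Subgroup G) [K.Normal] (hK : K ≤ N)
    (hn : ∀ j, (n j : G) ∈ K) : N ≤ K := by
  have h0 : ∀ i : Fin (s + 1), (x i.castSucc : G ⧸ K) ∈ Subgroup.zpowers (x 0 : G ⧸ K) := by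
    intro i
    refine Fin.cases ?_ (fun j => ?_) i
    · exact Subgroup.mem_zpowers _
    · rw [h j, QuotientGroup.mk_mul, (QuotientGroup.eq_one_iff _).2 (hn j), one_mul,
        QuotientGroup.mk_pow]
      exact Subgroup.npow_mem_zpowers _ _
  have hlast : (x (Fin.last _) : G ⧸ K) ∈ Subgroup.zpowers (x 0 : G ⧸ K) := by
    have hprod := H.prod_eq
    rw [List.ofFn_succ', List.concat_eq_append, List.prod_append, List.prod_singleton] at hprod
    have h1 : x (Fin.last _) = ((List.ofFn fun i : Fin (s + 1) => x i.castSucc).prod)⁻¹ :=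
      (inv_eq_of_mul_eq_one_right hprod).symm
    rw [h1, QuotientGroup.mk_inv]
    refine inv_mem ?_
    have : ((List.ofFn fun i : Fin (s + 1) => x i.castSucc).prod : G ⧸ K)
        = QuotientGroup.mk' K (List.ofFn fun i : Fin (s + 1) => x i.castSucc).prod := rfl
    rw [this, map_list_prod]
    refine Subgroup.list_prod_mem _ fun y hy => ?_
    simp only [List.map_ofFn, List.mem_ofFn] at hy
    obtain ⟨i, rfl⟩ := hy
    exact h0 i
  have htop : ∀ g : G, (g : G ⧸ K) ∈ Subgroup.zpowers (x 0 : G ⧸ K) := by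
    have : (⊤ : Subgroup G) ≤ (Subgroup.zpowers (x 0 : G ⧸ K)).comap (QuotientGroup.mk' K) := by
      rw [← H.closure_eq, Subgroup.closure_le]
      rintro _ ⟨i, rfl⟩
      refine Fin.lastCases ?_ (fun j => ?_) i
      · exact hlast
      · exact h0 j
    exact fun g => this trivial
  intro g hg
  have hfin : IsOfFinOrder (x 0 : G ⧸ K) := by
    refine isOfFinOrder_iff_pow_eq_one.2 ⟨p, H.prime_p.pos, ?_⟩
    rw [← QuotientGroup.mk_pow, H.pow_eq, QuotientGroup.mk_one]
  obtain ⟨e, he⟩ := hfin.mem_powers_iff_mem_zpowers.2 (htop g)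
  have he' : ((x 0 ^ e : G) : G ⧸ K) = g := he
  have h1 : g⁻¹ * x 0 ^ e ∈ K := QuotientGroup.eq.1 he'.symm
  have h2 : x 0 ^ e ∈ N := by
    have := mul_mem hg (hK h1)
    rwa [mul_inv_cancel_left] at this
  obtain ⟨c, rfl⟩ := (pow_mem_iff_of_notMem H.prime_p H.index_eq (H.notMem 0) e).1 h2
  rw [pow_mul, H.pow_eq, one_pow, mul_one] at h1
  exact (inv_mem_iff).1 h1

omit [N.Normal] in
lemma pow_eq_one_of_coprime (H : IsEllipticSystem N p q s x) {A : Type} [Group A] {a : A}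
    (h1 : a ^ p = 1) (h2 : a ^ q = 1) : a = 1 := by
  have := pow_gcd_eq_one.2 ⟨h1, h2⟩
  rwa [(Nat.coprime_primes H.prime_p H.prime_q).2 H.ne, pow_one] at this

/-- The action of `G / N` on the non-trivial characters of `N` is free. -/
lemma mem_of_conjHom_eq (H : IsEllipticSystem N p q s x) {A : Type} [CommGroup A] {V : N →* A}
    (hV : V ≠ 1) {g : G} (hg : conjHom g V = V) : g ∈ N := by
  by_contra hgN
  refine hV ?_
  have hpow : ∀ e : ℕ, conjHom (g ^ e) V = V := by
    intro e
    induction e with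
    | zero => simp [conjHom_one]
    | succ e ih => rw [pow_succ, conjHom_mul, hg, ih]
  -- N and `g` together generate G because the index is prime, so V is invariant under all of G.
  have hst : ∀ y : G, conjHom y V = V := by
    intro y
    obtain ⟨e, n, rfl⟩ := exists_eq_mul_pow_of_notMem H.prime_p H.index_eq hgN y
    rw [conjHom_mul, hpow, conjHom_of_mem H.comm n.2]
  have hst' : ∀ (y : G) (n : N), V (MulAut.conjNormal y n) = V n := by
    intro y n
    have := DFunLike.congr_fun (hst y⁻¹) n
    rwa [conjHom_apply, inv_inv] at this
  obtain ⟨a, n, h⟩ := H.exists_exponent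
  have : (V.ker.map N.subtype).Normal := by
    refine ⟨?_⟩
    rintro _ ⟨m, hm, rfl⟩ y
    refine ⟨MulAut.conjNormal y m, ?_, by simp⟩
    exact (hst' y m).trans hm
  -- Expanding `(n j * x 0 ^ a j) ^ p = 1` gives a product of p conjugates of `n j`; invariance
  -- turns its image under V into `V (n j) ^ p`.
  have hle := H.le_of_forall_mem h (V.ker.map N.subtype) (Subgroup.map_subtype_le _) fun j => by
    refine ⟨n j, ?_, rfl⟩
    obtain ⟨m, h1, h2⟩ := exists_mul_pow_eq V (n j) (x 0 ^ a j) p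
    rw [← h j, H.pow_eq, ← pow_mul, mul_comm, pow_mul, H.pow_eq, one_pow, mul_one] at h1
    have hm : m = 1 := by ext; exact h1.symm
    rw [hm, map_one] at h2
    simp only [hst', Finset.prod_const, Finset.card_range] at h2
    refine H.pow_eq_one_of_coprime h2.symm ?_
    rw [← map_pow, H.pow_q, map_one]
  ext m
  obtain ⟨m', hm', e⟩ := hle m.2
  have : m' = m := by ext; exact e
  exact this ▸ hm'

-- A finite-index subgroup of a finitely generated group is finitely generated, and a finitely
-- generated abelian torsion group is finite.
omit [N.Normal] in
lemma finite (H : IsEllipticSystem N p q s x) : Finite N := by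
  have : Group.FG G := by
    rw [Group.fg_iff]
    exact ⟨_, H.closure_eq, Set.finite_range x⟩
  have : N.FiniteIndex := ⟨by rw [H.index_eq]; exact H.prime_p.ne_zero⟩
  let : CommGroup N := { (inferInstance : Group N) with mul_comm := H.comm }
  refine CommGroup.finite_of_fg_isMulTorsion N fun n => ?_
  exact isOfFinOrder_iff_pow_eq_one.2 ⟨q, H.prime_q.pos, H.pow_q n⟩

omit [N.Normal] in
lemma mem_rootsOfUnity (H : IsEllipticSystem N p q s x) (V : N →* ℂˣ) (n : N) :
    V n ∈ rootsOfUnity q ℂ := by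
  rw [mem_rootsOfUnity', ← Units.val_pow_eq_pow_val, ← map_pow, H.pow_q, map_one, Units.val_one]

/-- The values of a character of `N` on the conjugates of the `n j`. -/
def evalConj (H : IsEllipticSystem N p q s x) (n : Fin s → N) (V : N →* ℂˣ) :
    Fin s → Fin (p - 1) → rootsOfUnity q ℂ := fun j k =>
  ⟨V (MulAut.conjNormal (x j.succ.castSucc ^ (k : ℕ)) (n j)), H.mem_rootsOfUnity V _⟩

/-- The norm relation for `n j` supplies the missing conjugate k = p - 1. Since N is abelian, the
powers of `x j.succ.castSucc` already produce all G-conjugates of `n j`, and these generate N. -/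
lemma eq_one_of_evalConj (H : IsEllipticSystem N p q s x) {a : Fin s → ℕ} {n : Fin s → N}
    (h : ∀ j, x j.succ.castSucc = n j * x 0 ^ a j) (U : N →* ℂˣ)
    (hU : ∀ j, ∀ k < p - 1, U (MulAut.conjNormal (x j.succ.castSucc ^ k) (n j)) = 1) : U = 1 := by
  have hp1 : p - 1 + 1 = p := Nat.sub_add_cancel H.prime_p.one_le
  have hU1 : ∀ j, ∀ k < p, U (MulAut.conjNormal (x j.succ.castSucc ^ k) (n j)) = 1 := by
    intro j k hk
    rcases Nat.lt_or_ge k (p - 1) with hk' | hk'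
    · exact hU j k hk'
    obtain rfl : k = p - 1 := by omega
    -- The norm relation comes from `(n j)⁻¹ * x j.succ.castSucc = x 0 ^ a j`, whose p-th power is
    -- 1.
    obtain ⟨m, h1, h2⟩ := exists_mul_pow_eq U (n j)⁻¹ (x j.succ.castSucc) p
    have e : (((n j)⁻¹ : N) : G) * x j.succ.castSucc = x 0 ^ a j := by rw [h j]; simp
    rw [e, H.pow_eq, ← pow_mul, mul_comm, pow_mul, H.pow_eq, one_pow, mul_one] at h1
    have hm : m = 1 := by ext; exact h1.symm
    rw [hm, map_one, ← hp1, Finset.prod_range_succ, Finset.prod_eq_one, one_mul] at h2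
    · simpa using h2
    · intro i hi
      rw [map_inv, map_inv, hU j i (Finset.mem_range.1 hi), inv_one]
  have hU2 : ∀ j (y : G), U (MulAut.conjNormal y (n j)) = 1 := by
    intro j y
    obtain ⟨e, m, rfl⟩ := exists_eq_mul_pow_of_notMem H.prime_p H.index_eq
      (H.notMem j.succ.castSucc) y
    have e1 : x j.succ.castSucc ^ e = x j.succ.castSucc ^ (e % p) := by
      conv_lhs => rw [← Nat.div_add_mod e p, pow_add, pow_mul, H.pow_eq, one_pow, one_mul]
    have e2 := conjHom_of_mem H.comm (inv_mem m.2) U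
    rw [map_mul, MulAut.mul_apply]
    have e3 := DFunLike.congr_fun e2
      (MulAut.conjNormal (x j.succ.castSucc ^ e) (n j))
    rw [conjHom_apply, inv_inv] at e3
    rw [e3, e1, hU1 j _ (Nat.mod_lt _ H.prime_p.pos)]
  -- The common kernel of all conjugates of U: the largest subgroup of `U.ker` that is normal in G.
  let K : Subgroup G := (⨅ y : G, (conjHom y U).ker).map N.subtype
  have hmem : ∀ m : N, (m : G) ∈ K ↔ ∀ y : G, conjHom y U m = 1 := by
    intro m
    simp only [K, Subgroup.mem_map, Subgroup.mem_iInf, MonoidHom.mem_ker, Subgroup.subtype_apply]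
    constructor
    · rintro ⟨m', h1, h2⟩
      obtain rfl : m' = m := by ext; exact h2
      exact h1
    · exact fun h => ⟨m, h, rfl⟩
  have : K.Normal := by
    refine ⟨fun z hz y => ?_⟩
    have hzN : z ∈ N := Subgroup.map_subtype_le _ hz
    have h1 := (hmem ⟨z, hzN⟩).1 hz
    have := (hmem (MulAut.conjNormal y ⟨z, hzN⟩)).2 fun w => by
      have := h1 (y⁻¹ * w)
      rw [conjHom_apply] at this ⊢
      rwa [mul_inv_rev, inv_inv, map_mul, MulAut.mul_apply] at this
    simpa using this
  have hle := H.le_of_forall_mem h K (Subgroup.map_subtype_le _) fun j => by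
    rw [hmem]
    intro y
    exact hU2 j y⁻¹
  ext m
  have := (hmem m).1 (hle m.2) 1
  rw [conjHom_one] at this
  rw [this]; rfl

lemma evalConj_injective (H : IsEllipticSystem N p q s x) {a : Fin s → ℕ} {n : Fin s → N}
    (h : ∀ j, x j.succ.castSucc = n j * x 0 ^ a j) : Function.Injective (H.evalConj n) := by
  intro V W hVW
  have : V / W = 1 := by
    refine H.eq_one_of_evalConj h _ fun j k hk => ?_
    have := congrArg Subtype.val (congrFun (congrFun hVW j) ⟨k, hk⟩)
    rw [MonoidHom.div_apply, div_eq_one]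
    exact this
  exact div_eq_one.1 this

end IsEllipticSystem

/-! ### Homomorphisms from the Fuchsian group to a wreath product. -/

section Wreath

variable {D C : Type} [CommGroup D] [Group C]

lemma wreath_pow_right (w : D ≀ᵣ C) (k : ℕ) : (w ^ k).right = w.right ^ k :=
  map_pow RegularWreathProduct.rightHom w k

lemma wreath_pow_left (w : D ≀ᵣ C) (k : ℕ) (y : C) :
    (w ^ k).left y = ∏ i ∈ Finset.range k, w.left ((w.right ^ i)⁻¹ * y) := by
  induction k with
  | zero => simp
  | succ k ih =>
    rw [pow_succ, Finset.prod_range_succ, RegularWreathProduct.mul_left, Pi.mul_apply, ih,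
      wreath_pow_right]

lemma bijective_pow_inv_mul [Fintype C] {p : ℕ} (hp : p.Prime) (hC : Nat.card C = p) {c : C}
    (hc : c ≠ 1) (y : C) : Function.Bijective fun i : Fin p => (c ^ (i : ℕ))⁻¹ * y := by
  have h1 : orderOf c = p := by
    rcases (Nat.dvd_prime hp).1 (hC ▸ orderOf_dvd_natCard c) with h | h
    · exact absurd (orderOf_eq_one_iff.1 h) hc
    · exact h
  rw [Fintype.bijective_iff_injective_and_card]
  refine ⟨fun i j hij => ?_, by rw [Fintype.card_fin, ← Nat.card_eq_fintype_card, hC]⟩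
  have h2 : c ^ (i : ℕ) = c ^ (j : ℕ) := by simpa using hij
  exact Fin.ext (pow_injOn_Iio_orderOf (by simp [h1]) (by simp [h1]) h2)

/-- As `w.right` generates C, the coordinate of `w ^ p` at `y` multiplies the values of `w.left`
along an orbit that meets each point of C once; so every coordinate is the full product. -/
lemma wreath_pow_eq_one [Fintype C] {p : ℕ} (hp : p.Prime) (hC : Nat.card C = p) (w : D ≀ᵣ C)
    (hw : w.right ≠ 1) (h : ∏ y, w.left y = 1) : w ^ p = 1 := by
  refine RegularWreathProduct.ext (funext fun y => ?_) ?_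
  · rw [wreath_pow_left, ← Fin.prod_univ_eq_prod_range (fun i => w.left ((w.right ^ i)⁻¹ * y)) p,
      (bijective_pow_inv_mul hp hC hw y).prod_comp w.left, h]
    rfl
  · rw [wreath_pow_right, ← hC, pow_card_eq_one']
    rfl

/-- The product of all the coordinates. -/
def wreathProd (D C : Type) [CommGroup D] [Group C] [Fintype C] : D ≀ᵣ C →* D where
  toFun w := ∏ y, w.left y
  map_one' := by simp
  map_mul' v w := by
    simp only [RegularWreathProduct.mul_left, Pi.mul_apply, Finset.prod_mul_distrib]
    congr 1
    exact Fintype.prod_equiv (Equiv.mulLeft v.right⁻¹) _ _ fun _ => rfl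

/-- The homomorphism from the Fuchsian group to a wreath product with prescribed values on all the
canonical generators but the last. -/
lemma exists_hom_wreath [Fintype C] {p s : ℕ} (hp : p.Prime) (hC : Nat.card C = p)
    (π : FuchsianGroup p (s + 2) →* C) (hπ : ∀ i, π (ellipticGen p (s + 2) i) ≠ 1)
    (a : Fin s → C → D) (ha : ∀ j, ∏ y, a j y = 1) :
    ∃ F : FuchsianGroup p (s + 2) →* D ≀ᵣ C,
      (∀ g, (F g).right = π g) ∧
      F (ellipticGen p (s + 2) 0) = ⟨1, π (ellipticGen p (s + 2) 0)⟩ ∧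
      ∀ j : Fin s, F (ellipticGen p (s + 2) j.succ.castSucc) =
        ⟨a j, π (ellipticGen p (s + 2) j.succ.castSucc)⟩ := by
  let c : Fin (s + 2) → C := fun i => π (ellipticGen p (s + 2) i)
  let u : Fin (s + 1) → D ≀ᵣ C :=
    Fin.cons ⟨1, c 0⟩ fun j : Fin s => ⟨a j, c j.succ.castSucc⟩
  have hu : ∀ i, (u i).right = c i.castSucc := fun i => Fin.cases rfl (fun j => rfl) i
  have hu' : ∀ i, wreathProd D C (u i) = 1 := fun i =>
    Fin.cases (by simp [u, wreathProd]) (fun j => ha j) i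
  -- The product relation dictates the value at the last generator. It has p-th power 1 like the
  -- others: its image in C is the non-trivial `c (Fin.last _)`, and the product of its coordinates
  -- is 1 because `wreathProd` is multiplicative.
  let z : D ≀ᵣ C := (List.ofFn u).prod⁻¹
  let v : Fin (s + 2) → D ≀ᵣ C := Fin.snoc (α := fun _ => D ≀ᵣ C) u z
  have hv1 : ∀ i : Fin (s + 1), v i.castSucc = u i := fun i => by simp [v]
  have hv2 : v (Fin.last (s + 1)) = z := by simp [v]
  have hcprod : (List.ofFn c).prod = 1 := by
    have h1 : (PresentedGroup.mk (relators p (s + 2)))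
        (List.ofFn fun i : Fin (s + 2) => FreeGroup.of i).prod = 1 :=
      PresentedGroup.one_of_mem (Or.inr rfl)
    have h2 := congrArg π h1
    rw [map_one, map_list_prod, map_list_prod, List.map_ofFn, List.map_ofFn] at h2
    exact h2
  have hz : z.right = c (Fin.last _) := by
    rw [List.ofFn_succ', List.concat_eq_append, List.prod_append, List.prod_singleton] at hcprod
    have h1 : z.right = ((List.ofFn fun i : Fin (s + 1) => c i.castSucc).prod)⁻¹ := by
      have : z.right = (RegularWreathProduct.rightHom (List.ofFn u).prod)⁻¹ := rfl
      rw [this, map_list_prod, List.map_ofFn]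
      congr 3
      exact funext hu
    rw [h1]
    exact inv_eq_of_mul_eq_one_right hcprod
  have hvr : ∀ i, (v i).right = c i := by
    intro i
    refine Fin.lastCases ?_ (fun j => ?_) i
    · rw [hv2, hz]
    · rw [hv1, hu]
  have hvp : ∀ i, wreathProd D C (v i) = 1 := by
    intro i
    refine Fin.lastCases ?_ (fun j => ?_) i
    · rw [hv2, map_inv, map_list_prod, List.map_ofFn, inv_eq_one]
      refine List.prod_eq_one fun y hy => ?_
      obtain ⟨i, rfl⟩ := (List.mem_ofFn' _ _).1 hy
      exact hu' i
    · rw [hv1, hu']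
  have hrel : ∀ w ∈ relators p (s + 2), FreeGroup.lift v w = 1 := by
    rintro w (⟨i, rfl⟩ | rfl)
    · simp only [map_pow, FreeGroup.lift_apply_of]
      refine wreath_pow_eq_one hp hC _ ?_ (hvp i)
      rw [hvr]
      exact hπ i
    · rw [map_list_prod, List.map_ofFn]
      have : (FreeGroup.lift v : FreeGroup (Fin (s + 2)) → D ≀ᵣ C) ∘
          (fun i : Fin (s + 2) => FreeGroup.of i) = v := by
        funext i; simp
      rw [this, List.ofFn_succ', List.concat_eq_append, List.prod_append, List.prod_singleton, hv2]
      simp only [hv1, z]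
      exact mul_inv_cancel _
  refine ⟨PresentedGroup.toGroup hrel, ?_, ?_, ?_⟩
  · intro g
    have : RegularWreathProduct.rightHom.comp (PresentedGroup.toGroup hrel) = π := by
      refine PresentedGroup.ext fun i => ?_
      simpa [c, ellipticGen] using hvr i
    exact DFunLike.congr_fun this g
  · have : ellipticGen p (s + 2) 0 = PresentedGroup.of (Fin.castSucc 0) := rfl
    rw [this, PresentedGroup.toGroup.of, hv1]
    rfl
  · intro j
    rw [ellipticGen, PresentedGroup.toGroup.of, hv1]
    rfl

end Wreath

/-! ### The order of the dual of Γ/Γ_q. -/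

section LiftGroup

lemma homologyKernel_le {Δ : Type} [Group Δ] (Γ : Subgroup Δ) [Γ.Normal] (q : ℕ) :
    homologyKernel Γ q ≤ Γ := by
  refine sup_le (Subgroup.commutator_le_left _ _) ((Subgroup.closure_le _).2 ?_)
  rintro _ ⟨g, hg, rfl⟩
  exact pow_mem hg q

lemma mk_mem_homologyGroup {Δ : Type} [Group Δ] {Γ : Subgroup Δ} [Γ.Normal] {q : ℕ} {g : Δ} :
    (g : LiftGroup Γ q) ∈ homologyGroup Γ q ↔ g ∈ Γ := by
  constructor
  · rintro ⟨h, hh, e⟩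
    have h1 : h⁻¹ * g ∈ homologyKernel Γ q := QuotientGroup.eq.1 e
    have := mul_mem hh (homologyKernel_le Γ q h1)
    rwa [mul_inv_cancel_left] at this
  · exact fun h => ⟨g, h, rfl⟩

/-- The images of the canonical generators in `Δ / Γ_q`. -/
def liftGen (p r : ℕ) (Γ : Subgroup (FuchsianGroup p r)) [Γ.Normal] (q : ℕ) (i : Fin r) :
    LiftGroup Γ q := (ellipticGen p r i : FuchsianGroup p r)

lemma isEllipticSystem_liftGen {p q s : ℕ} (hp : p.Prime) (hq : q.Prime) (hpq : p ≠ q)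
    {Γ : Subgroup (FuchsianGroup p (s + 2))} [Γ.Normal] (hΓ : IsSurfaceKernel p (s + 2) Γ) :
    IsEllipticSystem (homologyGroup Γ q) p q s (liftGen p (s + 2) Γ q) where
  prime_p := hp
  prime_q := hq
  ne := hpq
  pow_eq i := by
    have : ellipticGen p (s + 2) i ^ p = 1 := by
      have h1 : (PresentedGroup.mk (relators p (s + 2))) (FreeGroup.of i ^ p) = 1 :=
        PresentedGroup.one_of_mem (Or.inl ⟨i, rfl⟩)
      rw [map_pow] at h1
      exact h1
    rw [liftGen, ← QuotientGroup.mk_pow, this, QuotientGroup.mk_one]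
  prod_eq := by
    have h1 : (PresentedGroup.mk (relators p (s + 2)))
        (List.ofFn fun i : Fin (s + 2) => FreeGroup.of i).prod = 1 :=
      PresentedGroup.one_of_mem (Or.inr rfl)
    have h2 := congrArg (QuotientGroup.mk' (homologyKernel Γ q)) h1
    rw [map_one, map_list_prod, map_list_prod, List.map_ofFn, List.map_ofFn] at h2
    exact h2
  closure_eq := by
    have h1 := PresentedGroup.closure_range_of (relators p (s + 2))
    have h2 := congrArg (Subgroup.map (QuotientGroup.mk' (homologyKernel Γ q))) h1
    rw [MonoidHom.map_closure, ← Set.range_comp, Subgroup.map_top_of_surjective _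
      (QuotientGroup.mk'_surjective _)] at h2
    exact h2
  notMem i h := hΓ.gen_notMem i (mk_mem_homologyGroup.1 h)
  index_eq := by
    rw [homologyGroup, Subgroup.index_map_eq Γ (QuotientGroup.mk'_surjective _)
      (by rw [QuotientGroup.ker_mk']; exact homologyKernel_le Γ q), hΓ.index_eq]
  comm := by
    rintro ⟨_, a, ha, rfl⟩ ⟨_, b, hb, rfl⟩
    ext
    refine QuotientGroup.eq.2 ?_
    refine Subgroup.mem_sup_left ?_
    have := Subgroup.commutator_mem_commutator (inv_mem hb) (inv_mem ha)
    simpa [commutatorElement_def, mul_assoc] using this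
  pow_q := by
    rintro ⟨_, a, ha, rfl⟩
    ext
    rw [Subgroup.coe_pow, ← map_pow]
    refine (QuotientGroup.eq_one_iff _).2 (Subgroup.mem_sup_right ?_)
    exact Subgroup.subset_closure ⟨a, ha, rfl⟩

/-- Supplies the p-th coordinate required by the norm relation when the first p - 1 are prescribed.
-/
lemma exists_prod_range_eq_one {D : Type} [CommGroup D] {p : ℕ} (hp : 1 ≤ p)
    (b : Fin (p - 1) → D) :
    ∃ b' : ℕ → D, (∀ k : Fin (p - 1), b' k = b k) ∧ ∏ i ∈ Finset.range p, b' i = 1 := by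
  refine ⟨fun i => if h : i < p - 1 then b ⟨i, h⟩ else (∏ k, b k)⁻¹, fun k => by simp, ?_⟩
  have h : p - 1 + 1 = p := Nat.sub_add_cancel hp
  rw [show Finset.range p = Finset.range (p - 1 + 1) by rw [h], Finset.prod_range_succ,
    ← Fin.prod_univ_eq_prod_range]
  simp

/-- The prescribed values become coordinates of elements of a wreath product. Conjugation by a power
of a generator permutes coordinates, so a single coordinate of the resulting map on Γ sees all of
them. -/
lemma evalConj_surjective {p q s : ℕ} {Γ : Subgroup (FuchsianGroup p (s + 2))} [Γ.Normal]
    (hΓ : IsSurfaceKernel p (s + 2) Γ)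
    (H : IsEllipticSystem (homologyGroup Γ q) p q s (liftGen p (s + 2) Γ q))
    {a : Fin s → ℕ} {n : Fin s → homologyGroup Γ q}
    (h : ∀ j, liftGen p (s + 2) Γ q j.succ.castSucc = n j * liftGen p (s + 2) Γ q 0 ^ a j) :
    Function.Surjective (H.evalConj n) := by
  intro b
  have hp := H.prime_p
  have hC : Nat.card (FuchsianGroup p (s + 2) ⧸ Γ) = p := hΓ.index_eq
  have : Finite (FuchsianGroup p (s + 2) ⧸ Γ) := 
    Nat.finite_of_card_ne_zero (by rw [hC]; exact hp.ne_zero)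
  have := Fintype.ofFinite (FuchsianGroup p (s + 2) ⧸ Γ)
  let π := QuotientGroup.mk' Γ
  have hπ : ∀ i, π (ellipticGen p (s + 2) i) ≠ 1 := fun i hi =>
    hΓ.gen_notMem i ((QuotientGroup.eq_one_iff _).1 hi)
  choose b' hb1 hb2 using fun j => exists_prod_range_eq_one hp.one_le (b j)
  -- For each j the points of Δ/Γ are listed as c⁻ⁱ, with c the image of the j-th generator.
  -- Conjugating by its k-th power moves the coordinate at c⁻ᵏ to the coordinate at 1.
  let e : Fin s → Fin p ≃ FuchsianGroup p (s + 2) ⧸ Γ := fun j =>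
    Equiv.ofBijective _ (bijective_pow_inv_mul hp hC (hπ j.succ.castSucc) 1)
  let f : Fin s → (FuchsianGroup p (s + 2) ⧸ Γ) → rootsOfUnity q ℂ := fun j y =>
    b' j ((e j).symm y)
  have hf : ∀ j, ∏ y, f j y = 1 := fun j => by
    rw [← (e j).prod_comp]
    simp only [f, Equiv.symm_apply_apply]
    rw [Fin.prod_univ_eq_prod_range, hb2]
  obtain ⟨F, hF1, hF2, hF3⟩ := exists_hom_wreath (D := rootsOfUnity q ℂ) hp hC π hπ f hf
  have hright : ∀ g ∈ Γ, (F g).right = 1 := fun g hg => by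
    rw [hF1]; exact (QuotientGroup.eq_one_iff _).2 hg
  -- F maps Γ into the base group, which is abelian of exponent q.
  have hker : homologyKernel Γ q ≤ F.ker := by
    refine sup_le ?_ ((Subgroup.closure_le _).2 ?_)
    · rw [Subgroup.commutator_le]
      intro g hg k hk
      rw [MonoidHom.mem_ker, commutatorElement_def, map_mul, map_mul, map_mul, map_inv, map_inv,
        mul_inv_eq_one, mul_inv_eq_iff_eq_mul]
      refine RegularWreathProduct.ext ?_ ?_
      · simp only [RegularWreathProduct.mul_left, hright g hg, hright k hk, inv_one, one_mul]
        exact mul_comm _ _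
      · simp [hright g hg, hright k hk]
    · rintro _ ⟨g, hg, rfl⟩
      rw [SetLike.mem_coe, MonoidHom.mem_ker, map_pow]
      refine RegularWreathProduct.ext (funext fun y => ?_) ?_
      · simp only [wreath_pow_left, hright g hg, one_pow, inv_one, one_mul, Finset.prod_const,
          Finset.card_range]
        exact Subtype.ext ((F g).left y).2
      · rw [wreath_pow_right, hright g hg, one_pow]; rfl
  let Fb : LiftGroup Γ q →* rootsOfUnity q ℂ ≀ᵣ (FuchsianGroup p (s + 2) ⧸ Γ) :=
    QuotientGroup.lift _ F hker
  have hFb : ∀ m : homologyGroup Γ q, (Fb m).right = 1 := by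
    rintro ⟨_, g, hg, rfl⟩
    exact hright g hg
  let V : homologyGroup Γ q →* ℂˣ :=
    { toFun := fun m => (Fb m).left 1
      map_one' := by simp
      map_mul' := fun m m' => by
        simp [hFb m] }
  refine ⟨V, ?_⟩
  funext j k
  refine Subtype.ext ?_
  have hx0 : Fb (liftGen p (s + 2) Γ q 0) = ⟨1, π (ellipticGen p (s + 2) 0)⟩ := hF2
  have hxj : Fb (liftGen p (s + 2) Γ q j.succ.castSucc) =
    ⟨f j, π (ellipticGen p (s + 2) j.succ.castSucc)⟩ := hF3 j
  -- Powers of `x 0` have trivial coordinates, so dividing the j-th generator by such a power leaves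
  -- its coordinates unchanged.
  have hx0l : ∀ i : ℕ, (Fb (liftGen p (s + 2) Γ q 0) ^ i).left = 1 := fun i => by
    funext y
    rw [wreath_pow_left, hx0]
    simp
  have hnj : (Fb (n j)).left = f j := by
    have h1 := congrArg (fun w => (Fb w).left) (h j)
    simp only [map_mul, map_pow, hxj, RegularWreathProduct.mul_left, hx0l] at h1
    rw [h1]
    funext y
    simp
  have hgoal : (Fb (MulAut.conjNormal (liftGen p (s + 2) Γ q j.succ.castSucc ^ (k : ℕ)) (n j))).left
      1 = b j k := by
    rw [MulAut.conjNormal_apply, map_mul, map_mul, map_inv, map_pow]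
    simp only [RegularWreathProduct.mul_left, RegularWreathProduct.inv_left, Pi.mul_apply,
      RegularWreathProduct.mul_right, hnj, hFb, mul_one, mul_inv_cancel_left]
    rw [wreath_pow_right, hxj]
    simp only [Pi.inv_apply]
    rw [mul_right_comm, mul_inv_cancel, one_mul]
    have hk : (k : ℕ) < p := lt_of_lt_of_le k.2 (Nat.sub_le _ _)
    have h2 : (π (ellipticGen p (s + 2) j.succ.castSucc) ^ (k : ℕ))⁻¹ * 1 = e j ⟨k, hk⟩ := rfl
    rw [← mul_one (_ ^ (k : ℕ))⁻¹, h2]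
    simp only [f, Equiv.symm_apply_apply, hb1]
  exact congrArg Subtype.val hgoal

lemma card_homologyGroup_dual {p q s : ℕ} (hp : p.Prime) (hq : q.Prime) (hpq : p ≠ q)
    {Γ : Subgroup (FuchsianGroup p (s + 2))} [Γ.Normal] (hΓ : IsSurfaceKernel p (s + 2) Γ) :
    Nat.card (homologyGroup Γ q →* ℂˣ) = q ^ ((p - 1) * s) := by
  have H := isEllipticSystem_liftGen hp hq hpq hΓ
  obtain ⟨a, n, h⟩ := H.exists_exponent
  have hbij : Function.Bijective (H.evalConj n) :=
    ⟨H.evalConj_injective h, evalConj_surjective hΓ H h⟩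
  have : NeZero q := ⟨hq.ne_zero⟩
  rw [Nat.card_congr (Equiv.ofBijective _ hbij), Nat.card_fun, Nat.card_fun,
    Complex.card_rootsOfUnity, Nat.card_fin, Nat.card_fin, ← pow_mul]

end LiftGroup

/-! ### Irreducibility, Schur's lemma and representations of degree one. -/

section General

variable {G : Type} [Group G] {k : Type} [Field k]

lemma isIrreducible_of_forall {W : Type} [AddCommGroup W] [Module k W] [Nontrivial W]
    (ρ : Representation k G W)
    (h : ∀ S : Subrepresentation ρ, ∀ w ∈ S, w ≠ 0 → ∀ v, v ∈ S) : ρ.IsIrreducible := by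
  obtain ⟨w, hw⟩ := exists_ne (0 : W)
  have hne : (⊥ : Subrepresentation ρ) ≠ ⊤ := by
    intro e
    have h1 : w ∈ (⊤ : Subrepresentation ρ).toSubmodule := Submodule.mem_top
    rw [← e] at h1
    exact hw ((Submodule.mem_bot k).1 h1)
  refine { exists_pair_ne := ⟨_, _, hne⟩, eq_bot_or_eq_top := fun S => ?_ }
  by_cases hS : ∃ w ∈ S, w ≠ 0
  · obtain ⟨w, hw, hw0⟩ := hS
    right
    refine Subrepresentation.toSubmodule_injective (eq_top_iff.2 fun v _ => h S w hw hw0 v)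
  · left
    push Not at hS
    exact Subrepresentation.toSubmodule_injective (eq_bot_iff.2 fun v hv =>
      (Submodule.mem_bot k).2 (hS v hv))

lemma mem_of_isIrreducible {W : Type} [AddCommGroup W] [Module k W]
    {ρ : Representation k G W} (hρ : ρ.IsIrreducible) (S : Submodule k W)
    (hS : ∀ g, ∀ v ∈ S, ρ g v ∈ S) {w : W} (hw : w ∈ S) (hw0 : w ≠ 0) (v : W) : v ∈ S := by
  let T : Subrepresentation ρ := ⟨S, fun g v hv => hS g v hv⟩
  rcases hρ.eq_bot_or_eq_top T with h | h
  · have h1 : S = ⊥ := congrArg Subrepresentation.toSubmodule h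
    rw [h1] at hw
    exact absurd ((Submodule.mem_bot k).1 hw) hw0
  · have h1 : S = ⊤ := congrArg Subrepresentation.toSubmodule h
    rw [h1]; trivial

lemma nontrivial_of_isIrreducible {W : Type} [AddCommGroup W] [Module k W]
    {ρ : Representation k G W} (hρ : ρ.IsIrreducible) : Nontrivial W := by
  by_contra hn
  rw [not_nontrivial_iff_subsingleton] at hn
  obtain ⟨S, T, hST⟩ := hρ.exists_pair_ne
  exact hST (Subrepresentation.toSubmodule_injective (Subsingleton.elim _ _))

lemma nonempty_equiv_of_ne_zero {W W' : Type} [AddCommGroup W] [Module k W] [AddCommGroup W']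
    [Module k W'] {ρ : Representation k G W} {ρ' : Representation k G W'} (h : ρ.IsIrreducible)
    (h' : ρ'.IsIrreducible) (f : W →ₗ[k] W') (hf : ∀ g w, f (ρ g w) = ρ' g (f w)) {w : W}
    (hw : f w ≠ 0) : Nonempty (ρ.Equiv ρ') := by
  let F : ρ.IntertwiningMap ρ' := ⟨f, fun g => LinearMap.ext fun w => hf g w⟩
  rcases Representation.IsIrreducible.bijective_or_eq_zero F with hF | hF
  · exact ⟨F.ofBijective hF⟩
  · exact absurd (DFunLike.congr_fun hF w) hw

lemma equiv_apply {W W' : Type} [AddCommGroup W] [Module k W] [AddCommGroup W']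
    [Module k W'] {ρ : Representation k G W} {ρ' : Representation k G W'} (e : ρ.Equiv ρ') (g : G)
    (w : W) : e.toLinearEquiv (ρ g w) = ρ' g (e.toLinearEquiv w) :=
  LinearMap.congr_fun (e.isIntertwining' g) w

lemma charRep_apply (χ : G →* kˣ) (g : G) (a : k) : charRep χ g a = χ g * a := rfl

lemma charRep_isIrreducible (χ : G →* kˣ) : (charRep χ).IsIrreducible := by
  refine isIrreducible_of_forall _ fun S w hw hw0 v => ?_
  have : (v / w) • w ∈ S.toSubmodule := S.toSubmodule.smul_mem _ hw
  rwa [smul_eq_mul, div_mul_cancel₀ _ hw0] at this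

lemma eq_of_charRep_equiv {χ ψ : G →* kˣ} (h : Nonempty ((charRep χ).Equiv (charRep ψ))) :
    χ = ψ := by
  obtain ⟨e⟩ := h
  ext g
  have h1 := equiv_apply e g 1
  rw [charRep_apply, charRep_apply, ← smul_eq_mul, map_smul, smul_eq_mul] at h1
  exact mul_right_cancel₀ (e.toLinearEquiv.map_ne_zero_iff.2 one_ne_zero) h1

lemma nonempty_equiv_charRep {W : Type} [AddCommGroup W] [Module k W]
    {ρ : Representation k G W} (hρ : ρ.IsIrreducible) {χ : G →* kˣ} {w : W} (hw : w ≠ 0)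
    (h : ∀ g, ρ g w = (χ g : k) • w) : Nonempty (ρ.Equiv (charRep χ)) := by
  obtain ⟨e⟩ := nonempty_equiv_of_ne_zero (charRep_isIrreducible χ) hρ
    (LinearMap.toSpanSingleton k W w) (fun g a => by
      simp only [LinearMap.toSpanSingleton_apply, charRep_apply, map_smul, h, smul_smul]
      rw [mul_comm]) (w := 1) (by simpa using hw)
  exact ⟨e.symm⟩

end General

/-! ### Common eigenvectors of finite abelian groups. -/

section Eigen

variable {C : Type} [CommGroup C] [Finite C]

lemma sum_dual_apply [Fintype (C →* ℂˣ)] (c : C) (hc : c ≠ 1) :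
    ∑ V : C →* ℂˣ, (V c : ℂ) = 0 := by
  obtain ⟨φ, hφ⟩ := CommGroup.exists_apply_ne_one_of_hasEnoughRootsOfUnity C ℂ hc
  let f : (C →* ℂˣ) →* ℂ := (Units.coeHom ℂ).comp (MonoidHom.eval c)
  refine sum_hom_units_eq_zero f fun e => hφ ?_
  ext
  exact DFunLike.congr_fun e φ

/-- A representation of a finite abelian group on a non-zero complex vector space has a common
eigenvector. -/
lemma exists_common_eigenvector {W : Type} [AddCommGroup W] [Module ℂ W] [Nontrivial W]
    (ρ : Representation ℂ C W) :
    ∃ (V : C →* ℂˣ) (w : W), w ≠ 0 ∧ ∀ c, ρ c w = (V c : ℂ) • w := by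
  have := Fintype.ofFinite C
  have hfin : Finite (C →* ℂˣ) := Nat.finite_of_card_ne_zero (by
    rw [CommGroup.card_monoidHom_of_hasEnoughRootsOfUnity]; exact Nat.card_pos.ne')
  have := Fintype.ofFinite (C →* ℂˣ)
  obtain ⟨w, hw⟩ := exists_ne (0 : W)
  -- The inner sums are unnormalized projections of w to the V-eigenspaces. By orthogonality they
  -- add up to a non-zero multiple of w, so one of them is non-zero; W may have infinite dimension.
  have hsum : ∑ V : C →* ℂˣ, ∑ c : C, ((V c⁻¹ : ℂˣ) : ℂ) • ρ c w
      = (Fintype.card (C →* ℂˣ) : ℂ) • w := by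
    rw [Finset.sum_comm, Finset.sum_eq_single (1 : C)]
    · simp [Nat.cast_smul_eq_nsmul]
    · intro c _ hc
      rw [← Finset.sum_smul, sum_dual_apply _ (inv_ne_one.2 hc), zero_smul]
    · simp
  have hne : ∃ V : C →* ℂˣ, ∑ c : C, ((V c⁻¹ : ℂˣ) : ℂ) • ρ c w ≠ 0 := by
    by_contra! h
    rw [Finset.sum_eq_zero fun V _ => h V] at hsum
    refine smul_ne_zero ?_ hw hsum.symm
    exact_mod_cast Fintype.card_ne_zero
  obtain ⟨V, hV⟩ := hne
  refine ⟨V, _, hV, fun d => ?_⟩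
  rw [map_sum, Finset.smul_sum]
  refine Fintype.sum_equiv (Equiv.mulLeft d) _ _ fun c => ?_
  simp only [Equiv.coe_mulLeft, map_smul, smul_smul, map_mul, Module.End.mul_apply, mul_inv_rev,
    Units.val_mul]
  congr 1
  rw [mul_left_comm, ← Units.val_mul, ← map_mul, mul_inv_cancel, map_one, Units.val_one, mul_one]

end Eigen

/-! ### Representations generated by an eigenvector of N. -/

section Induced

variable {G : Type} [Group G] {N : Subgroup G} [N.Normal] {k : Type} [Field k]

/-- All conjugates of `V` under elements outside of `N` differ from `V`. -/
def IsFree {M : Type} [Monoid M] (V : N →* M) : Prop := ∀ g : G, conjHom g V = V → g ∈ N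

lemma IsFree.eq_of_conjHom_eq {M : Type} [Monoid M] {V : N →* M} (hV : IsFree V) {x y : G ⧸ N}
    (h : conjHom x.out V = conjHom y.out V) : x = y := by
  have : conjHom (x.out⁻¹ * y.out) V = V := by
    rw [conjHom_mul, ← h, ← conjHom_mul, inv_mul_cancel, conjHom_one]
  have h1 := QuotientGroup.eq.2 (hV _ this)
  rwa [QuotientGroup.out_eq', QuotientGroup.out_eq'] at h1

/-- The vector `v` generates `ρ`, and `N` acts on it by `V`. -/
structure IsInducedFrom {W : Type} [AddCommGroup W] [Module k W] (ρ : Representation k G W)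
    (V : N →* kˣ) (v : W) : Prop where
  ne_zero : v ≠ 0
  apply_eq : ∀ n : N, ρ n v = (V n : k) • v
  span_eq : Submodule.span k (Set.range fun g => ρ g v) = ⊤

variable {W : Type} [AddCommGroup W] [Module k W] {ρ : Representation k G W} {V : N →* kˣ} {v : W}

lemma apply_apply_eq (h : ∀ n : N, ρ n v = (V n : k) • v) (g : G) (n : N) :
    ρ n (ρ g v) = (conjHom g V n : k) • ρ g v := by
  have h1 : (n : G) * g = g * (MulAut.conjNormal g⁻¹ n : N) := by simp [mul_assoc]
  rw [← Module.End.mul_apply, ← map_mul, h1, map_mul, Module.End.mul_apply, h, map_smul,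
    conjHom_apply]

omit [N.Normal] in
lemma apply_eq_out (h : ∀ n : N, ρ n v = (V n : k) • v) (g : G) :
    ∃ n : N, g = (g : G ⧸ N).out * n ∧ ρ g v = (V n : k) • ρ (g : G ⧸ N).out v := by
  have hn : (g : G ⧸ N).out⁻¹ * g ∈ N := QuotientGroup.eq.1 (QuotientGroup.out_eq' _)
  have hg : g = (g : G ⧸ N).out * (⟨_, hn⟩ : N) := by simp
  refine ⟨⟨_, hn⟩, hg, ?_⟩
  conv_lhs => rw [hg, map_mul, Module.End.mul_apply, h, map_smul]

-- Eigenvectors for distinct characters: for i ≠ a some n separates `χ i` from `χ a`, and applying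
-- `ρ n - χ a n` to a relation removes `u a` but keeps `u i`.
omit [N.Normal] in
lemma linearIndependent_of_eigen {ι : Type} {u : ι → W} {χ : ι → N →* kˣ}
    (hχ : Function.Injective χ) (hu : ∀ i, u i ≠ 0) (h : ∀ i (n : N), ρ n (u i) = (χ i n : k) • u i) :
    LinearIndependent k u := by
  classical
  rw [linearIndependent_iff']
  intro s
  induction s using Finset.induction_on with
  | empty => simp
  | insert a s ha ih =>
    intro c hc
    have h1 : ∀ i ∈ s, c i = 0 := by
      intro i hi
      obtain ⟨n, hn⟩ : ∃ n : N, (χ i n : k) ≠ χ a n := by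
        by_contra! hcon
        exact ha ((hχ (MonoidHom.ext fun n => Units.ext (hcon n))) ▸ hi)
      have h2 := ih (fun j => c j * ((χ j n : k) - χ a n)) (by
        have e1 : ∑ j ∈ s, (c j * ((χ j n : k) - χ a n)) • u j =
            ρ n (∑ i ∈ insert a s, c i • u i) - (χ a n : k) • ∑ i ∈ insert a s, c i • u i := by
          rw [Finset.sum_insert ha, map_add, map_sum, smul_add, Finset.smul_sum, map_smul, h,
            smul_comm (c a), add_sub_add_left_eq_sub, ← Finset.sum_sub_distrib]
          refine Finset.sum_congr rfl fun j _ => ?_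
          rw [map_smul, h]
          module
        rw [e1, hc, map_zero, smul_zero, sub_zero]) i hi
      exact (mul_eq_zero.1 h2).resolve_right (sub_ne_zero.2 hn)
    rw [Finset.sum_insert ha, Finset.sum_eq_zero fun i hi => by rw [h1 i hi, zero_smul],
      add_zero] at hc
    intro i hi
    rcases Finset.mem_insert.1 hi with rfl | hi
    · exact (smul_eq_zero.1 hc).resolve_right (hu _)
    · exact h1 i hi

lemma apply_ne_zero (ρ : Representation k G W) {v : W} (hv : v ≠ 0) (g : G) : ρ g v ≠ 0 := by
  intro h
  refine hv ?_
  have := congrArg (ρ g⁻¹) h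
  rwa [map_zero, ← Module.End.mul_apply, ← map_mul, inv_mul_cancel, map_one,
    Module.End.one_apply] at this

lemma linearIndependent_out (hV : IsFree V) (hv : v ≠ 0) (h : ∀ n : N, ρ n v = (V n : k) • v) :
    LinearIndependent k fun x : G ⧸ N => ρ x.out v :=
  linearIndependent_of_eigen (χ := fun x : G ⧸ N => conjHom x.out V)
    (fun _ _ e => hV.eq_of_conjHom_eq e) (fun _ => apply_ne_zero ρ hv _)
    fun _ n => apply_apply_eq h _ n

/-- The translates by coset representatives have distinct characters, hence are independent; a
dimension equal to the index makes them span. -/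
lemma IsInducedFrom.of_finrank_eq [N.FiniteIndex] (hV : IsFree V) (hv : v ≠ 0)
    (h : ∀ n : N, ρ n v = (V n : k) • v) (hd : Module.finrank k W = N.index) :
    IsInducedFrom ρ V v where
  ne_zero := hv
  apply_eq := h
  span_eq := by
    have := Fintype.ofFinite (G ⧸ N)
    have : FiniteDimensional k W :=
      Module.finite_of_finrank_pos (hd ▸ Nat.pos_of_ne_zero Subgroup.FiniteIndex.index_ne_zero)
    have h1 := (linearIndependent_out hV hv h).span_eq_top_of_card_eq_finrank' (by
      rw [hd, Subgroup.index, Nat.card_eq_fintype_card])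
    rw [eq_top_iff, ← h1, Submodule.span_le]
    rintro _ ⟨x, rfl⟩
    exact Submodule.subset_span ⟨_, rfl⟩

omit [N.Normal] in
lemma IsInducedFrom.of_isIrreducible (hρ : ρ.IsIrreducible) (hv : v ≠ 0)
    (h : ∀ n : N, ρ n v = (V n : k) • v) : IsInducedFrom ρ V v where
  ne_zero := hv
  apply_eq := h
  span_eq := by
    rw [eq_top_iff]
    intro w _
    have hv' : v ∈ Submodule.span k (Set.range fun g => ρ g v) :=
      Submodule.subset_span ⟨1, by simp⟩
    refine mem_of_isIrreducible hρ _ (fun g u hu => ?_) hv' hv w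
    induction hu using Submodule.span_induction with
    | mem u hu =>
      obtain ⟨y, rfl⟩ := hu
      exact Submodule.subset_span ⟨g * y, by simp⟩
    | zero => simp
    | add _ _ _ _ h1 h2 => rw [map_add]; exact add_mem h1 h2
    | smul c _ _ h1 => rw [map_smul]; exact Submodule.smul_mem _ _ h1

namespace IsInducedFrom

variable (h : IsInducedFrom ρ V v) (hV : IsFree V)

/-- The basis of an induced representation given by a system of representatives of the cosets. -/
def basis : Module.Basis (G ⧸ N) k W :=
  Module.Basis.mk (linearIndependent_out hV h.ne_zero h.apply_eq) (by
    rw [← h.span_eq, Submodule.span_le]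
    rintro _ ⟨g, rfl⟩
    obtain ⟨n, -, hn⟩ := apply_eq_out h.apply_eq g
    simp only [SetLike.mem_coe]
    rw [hn]
    exact Submodule.smul_mem _ _ (Submodule.subset_span ⟨_, rfl⟩))

lemma basis_apply (x : G ⧸ N) : h.basis hV x = ρ x.out v := by
  simp [basis]

include h hV in
lemma finrank_eq : Module.finrank k W = N.index := by
  rw [Module.finrank_eq_nat_card_basis (h.basis hV), Subgroup.index]

-- Frobenius reciprocity. The map is prescribed on the coset basis; it commutes with G because the
-- remaining factor in N acts on `v` and `v'` by the same scalar.
include h hV in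
lemma exists_hom {W' : Type} [AddCommGroup W'] [Module k W'] {ρ' : Representation k G W'}
    {v' : W'} (h' : ∀ n : N, ρ' n v' = (V n : k) • v') :
    ∃ f : W →ₗ[k] W', (∀ g w, f (ρ g w) = ρ' g (f w)) ∧ f v = v' := by
  let f := (h.basis hV).constr k fun x => ρ' x.out v'
  have hf : ∀ x : G ⧸ N, f (ρ x.out v) = ρ' x.out v' := fun x => by
    rw [← h.basis_apply hV]; simp [f]
  have hf' : ∀ g, f (ρ g v) = ρ' g v' := fun g => by
    obtain ⟨n, hn, hn'⟩ := apply_eq_out h.apply_eq g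
    rw [hn', map_smul, hf]
    conv_rhs => rw [hn, map_mul, Module.End.mul_apply, h', map_smul]
  refine ⟨f, fun g => LinearMap.congr_fun (f := f ∘ₗ ρ g) (g := ρ' g ∘ₗ f)
    (LinearMap.ext_on_range h.span_eq fun y => ?_), ?_⟩
  · simp only [LinearMap.comp_apply]
    rw [hf', ← Module.End.mul_apply, ← map_mul, hf', map_mul, Module.End.mul_apply]
  · simpa using hf' 1

include h hV in
lemma exists_equiv {W' : Type} [AddCommGroup W'] [Module k W'] {ρ' : Representation k G W'}
    {v' : W'} (h' : IsInducedFrom ρ' V v') : Nonempty (ρ.Equiv ρ') := by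
  obtain ⟨f, hf, hfv⟩ := h.exists_hom hV h'.apply_eq
  obtain ⟨f', hf', hfv'⟩ := h'.exists_hom hV h.apply_eq
  have h1 : f ∘ₗ f' = LinearMap.id := LinearMap.ext_on_range h'.span_eq fun g => by
    simp [hf, hf', hfv, hfv']
  have h2 : f' ∘ₗ f = LinearMap.id := LinearMap.ext_on_range h.span_eq fun g => by
    simp [hf, hf', hfv, hfv']
  exact ⟨Representation.Equiv.mk (LinearEquiv.ofLinearMap f f' h1 h2) fun g =>
    LinearMap.ext fun w => hf g w⟩

/-- A weighted average over N acts diagonally on the coset basis, and here it retains only the line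
of `x`. Weights given by an inverse character yield irreducibility over k; indicator weights of a
kernel yield it over ℚ. -/
lemma sum_smul_apply [N.FiniteIndex] [Fintype N] (f : N → k) (x : G ⧸ N)
    (hf : ∀ y ≠ x, ∑ n, f n * (conjHom y.out V n : k) = 0) (w : W) :
    ∑ n : N, f n • ρ n w =
      ((h.basis hV).repr w x * ∑ n, f n * (conjHom x.out V n : k)) • ρ x.out v := by
  classical
  have := Fintype.ofFinite (G ⧸ N)
  have key : ∀ y : G ⧸ N, ∑ n : N, f n • ρ n (ρ y.out v) =
      (∑ n, f n * (conjHom y.out V n : k)) • ρ y.out v := fun y => by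
    rw [Finset.sum_smul]
    refine Finset.sum_congr rfl fun n _ => ?_
    rw [apply_apply_eq h.apply_eq, smul_smul]
  conv_lhs => rw [← (h.basis hV).sum_repr w]
  simp only [map_sum, map_smul, Finset.smul_sum, h.basis_apply]
  rw [Finset.sum_comm]
  have : ∀ y : G ⧸ N, ∑ n : N, f n • (h.basis hV).repr w y • ρ n (ρ y.out v) =
      ((h.basis hV).repr w y * ∑ n, f n * (conjHom y.out V n : k)) • ρ y.out v := fun y => by
    rw [mul_smul, ← key, Finset.smul_sum]
    exact Finset.sum_congr rfl fun n _ => smul_comm _ _ _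
  simp only [this]
  rw [Finset.sum_eq_single x]
  · intro y _ hy
    rw [hf y hy, mul_zero, zero_smul]
  · simp

-- The set `s` need only be closed under addition and G, so this applies also to ℚ-subspaces of a
-- K-space; all scalar multiples of one translate are therefore required.
omit [N.Normal] in
include h in
lemma mem_of_apply_mem {S : Type} [SetLike S W] [AddSubmonoidClass S W] (s : S)
    (hs : ∀ g, ∀ w ∈ s, ρ g w ∈ s) {y : G} (hy : ∀ c : k, c • ρ y v ∈ s) (w : W) : w ∈ s := by
  have hw : w ∈ Submodule.span k (Set.range fun g => ρ g v) := by rw [h.span_eq]; trivial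
  have key : ∀ (c : k) (g : G), c • ρ g v ∈ s := fun c g => by
    have := hs (g * y⁻¹) _ (hy c)
    rwa [map_smul, ← Module.End.mul_apply, ← map_mul, inv_mul_cancel_right] at this
  rw [Finsupp.mem_span_range_iff_exists_finsupp] at hw
  obtain ⟨c, rfl⟩ := hw
  exact sum_mem fun g _ => key _ _

lemma repr_apply (n : N) (w : W) (x : G ⧸ N) :
    (h.basis hV).repr (ρ n w) x = (conjHom x.out V n : k) * (h.basis hV).repr w x := by
  have : (h.basis hV).coord x ∘ₗ ρ n = (conjHom x.out V n : k) • (h.basis hV).coord x := by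
    refine (h.basis hV).ext fun y => ?_
    simp only [LinearMap.comp_apply, LinearMap.smul_apply]
    conv_lhs => rw [h.basis_apply, apply_apply_eq h.apply_eq, ← h.basis_apply hV]
    rw [map_smul]
    by_cases e : y = x
    · rw [e]
    · simp [e]
  exact LinearMap.congr_fun this w

include h in
lemma exists_repr_ne_zero {w : W} (hw : w ≠ 0) : ∃ x, (h.basis hV).repr w x ≠ 0 := by
  by_contra! hcon
  exact hw ((h.basis hV).repr.map_eq_zero_iff.1 (Finsupp.ext hcon))

include h hV in
/-- The characters of `N` which occur in an induced representation are the conjugates. -/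
lemma exists_conjHom_eq {w : W} (hw : w ≠ 0) {U : N →* kˣ} (hU : ∀ n : N, ρ n w = (U n : k) • w) :
    ∃ g : G, U = conjHom g V := by
  obtain ⟨x, hx⟩ := h.exists_repr_ne_zero hV hw
  refine ⟨x.out, MonoidHom.ext fun n => Units.ext ?_⟩
  have h1 := h.repr_apply hV n w x
  rw [hU, map_smul, Finsupp.smul_apply, smul_eq_mul] at h1
  exact mul_right_cancel₀ hx h1

-- Detects V up to conjugacy from fixed vectors alone. Unlike eigenvalues in K, these survive an
-- isomorphism that is merely ℚ-linear.
include h hV in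
lemma exists_le_ker_conjHom {w : W} (hw : w ≠ 0) {H : Subgroup N} (hH : ∀ n ∈ H, ρ n w = w) :
    ∃ g : G, H ≤ (conjHom g V).ker := by
  obtain ⟨x, hx⟩ := h.exists_repr_ne_zero hV hw
  refine ⟨x.out, fun n hn => Units.ext ?_⟩
  have h1 := h.repr_apply hV n w x
  rw [hH n hn] at h1
  exact (mul_eq_right₀ hx).1 h1.symm

-- Mackey's criterion: by orthogonality, averaging with the inverse of the conjugate character at
-- `x` projects onto a single line, whose translates span.
include h hV in
lemma isIrreducible [N.FiniteIndex] [Finite N] [CharZero k] : ρ.IsIrreducible := by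
  classical
  have := Fintype.ofFinite N
  have : Nontrivial W := ⟨v, 0, h.ne_zero⟩
  refine isIrreducible_of_forall _ fun S w hw hw0 => ?_
  obtain ⟨x, hx⟩ := h.exists_repr_ne_zero hV hw0
  let f : N → k := fun n => (conjHom x.out V n⁻¹ : kˣ)
  have hf : ∀ y ≠ x, ∑ n, f n * (conjHom y.out V n : k) = 0 := by
    intro y hy
    let φ : N →* k := (Units.coeHom k).comp (conjHom y.out V / conjHom x.out V)
    have hφ : φ ≠ 1 := by
      intro e
      refine hy (hV.eq_of_conjHom_eq (div_eq_one.1 (MonoidHom.ext fun n => Units.ext ?_)))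
      exact DFunLike.congr_fun e n
    rw [← sum_hom_units_eq_zero φ hφ]
    refine Finset.sum_congr rfl fun n _ => ?_
    simp only [f, φ, map_inv, MonoidHom.comp_apply, MonoidHom.div_apply, Units.coeHom_apply,
      div_eq_mul_inv, Units.val_mul]
    rw [mul_comm]
  have hfx : ∑ n, f n * (conjHom x.out V n : k) = Fintype.card N := by
    simp only [f, map_inv, Units.inv_mul, Finset.sum_const, nsmul_eq_mul, mul_one,
      Finset.card_univ]
  have hmem : ∑ n : N, f n • ρ n w ∈ S.toSubmodule := sum_mem fun n _ =>
    S.toSubmodule.smul_mem _ (S.apply_mem_toSubmodule _ hw)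
  rw [h.sum_smul_apply hV f x hf, hfx] at hmem
  have hne : (h.basis hV).repr w x * (Fintype.card N : k) ≠ 0 :=
    mul_ne_zero hx (Nat.cast_ne_zero.2 Fintype.card_ne_zero)
  refine h.mem_of_apply_mem S.toSubmodule (fun g w hw => S.apply_mem_toSubmodule g hw)
    (y := x.out) fun c => ?_
  have := S.toSubmodule.smul_mem (c / ((h.basis hV).repr w x * (Fintype.card N : k))) hmem
  rwa [smul_smul, div_mul_cancel₀ _ hne] at this

end IsInducedFrom

end Induced

/-! ### The induced representation is generated by its canonical vector. -/

section Ind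

open TensorProduct

variable {G : Type} [Group G] {N : Subgroup G} {k : Type} [Field k]

/-- The canonical generator of the representation induced from a linear character. -/
def indVec (V : N →* kˣ) : Representation.IndV N.subtype (charRep V) :=
  Representation.IndV.mk N.subtype (charRep V) 1 1

open Classical in
/-- The linear form on the induced representation which is `1` on the canonical generator and
vanishes on its translates by elements outside of `N`. -/
def indForm (V : N →* kˣ) : Representation.IndV N.subtype (charRep V) →ₗ[k] k :=
  Representation.Coinvariants.lift _
    (TensorProduct.lift ((Finsupp.lift (k →ₗ[k] k) k G fun h =>
        if hh : h ∈ N then ((V ⟨h, hh⟩⁻¹ : kˣ) : k) • LinearMap.id else 0) ∘ₗ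
      (MonoidAlgebra.coeffLinearEquiv k).toLinearMap)) fun n => by
    ext h
    have hiff : (n : G) * h ∈ N ↔ h ∈ N := N.mul_mem_cancel_left n.2
    by_cases hh : h ∈ N
    · have hm : (n : G) * h ∈ N := hiff.2 hh
      have e : (⟨(n : G) * h, hm⟩ : N) = n * ⟨h, hh⟩ := rfl
      simp [hh, hm, charRep_apply, e]
    · have hm : (n : G) * h ∉ N := fun h' => hh (hiff.1 h')
      simp [hh, hm]

lemma indForm_indVec (V : N →* kˣ) : indForm V (indVec V) = 1 := by
  have e : (⟨1, N.one_mem⟩ : N) = 1 := rfl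
  simp [indForm, indVec, N.one_mem, e]

lemma isInducedFrom_ind (V : N →* kˣ) :
    IsInducedFrom (Representation.ind N.subtype (charRep V)) V (indVec V) where
  ne_zero h := by
    have := indForm_indVec V
    rw [h, map_zero] at this
    exact zero_ne_one this
  apply_eq n := by
    have h1 := Representation.Coinvariants.mk_inv_tmul
      ((Representation.leftRegular k G).comp N.subtype) (charRep V)
      (MonoidAlgebra.single 1 1) (1 : k) n
    have h2 : charRep V n 1 = (V n : k) • (1 : k) := charRep_apply V n 1
    rw [h2, TensorProduct.tmul_smul, map_smul] at h1
    rw [indVec, Representation.ind_mk, ← indVec, indVec]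
    refine Eq.trans ?_ h1
    simp [Representation.IndV.mk]
  span_eq := by
    rw [eq_top_iff]
    rintro w -
    induction w using Representation.Coinvariants.induction_on with
    | h w =>
      induction w using TensorProduct.induction_on with
      | zero => rw [map_zero]; exact zero_mem _
      | add a b ha hb => rw [map_add]; exact add_mem ha hb
      | tmul f a =>
        induction f using MonoidAlgebra.induction_linear with
        | zero => rw [TensorProduct.zero_tmul, map_zero]; exact zero_mem _
        | add f g hf hg => rw [TensorProduct.add_tmul, map_add]; exact add_mem hf hg
        | single g c =>
          -- In this model G acts by right multiplication with the inverse, hence `g⁻¹`.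
          have h1 : Representation.ind N.subtype (charRep V) g⁻¹ (indVec V) =
              Representation.IndV.mk N.subtype (charRep V) g 1 := by
            rw [indVec, Representation.ind_mk]
            simp
          have h2 : (MonoidAlgebra.single g c : MonoidAlgebra k G) ⊗ₜ[k] a =
              (c * a) • ((MonoidAlgebra.single g 1 : MonoidAlgebra k G) ⊗ₜ[k] (1 : k)) := by
            rw [← TensorProduct.smul_tmul_smul]
            simp
          rw [h2, map_smul]
          exact Submodule.smul_mem _ _ (Submodule.subset_span ⟨g⁻¹, h1⟩)

end Ind

/-! ### The complex irreducible representations. -/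

section Complex

variable {G : Type} [Group G] {N : Subgroup G} [N.Normal] {p : ℕ}

/-- A non-zero complex representation of `G` contains an eigenvector of `G`, on which `N` acts
trivially, or an eigenvector of `N` with non-trivial character. -/
lemma exists_eigenvector [Finite N] (hp : p.Prime) (hN : N.index = p)
    (hc : ∀ a b : N, a * b = b * a) {W : Type} [AddCommGroup W] [Module ℂ W] [Nontrivial W]
    (ρ : Representation ℂ G W) :
    (∃ (ψ : G →* ℂˣ) (w : W), N ≤ ψ.ker ∧ w ≠ 0 ∧ ∀ g, ρ g w = (ψ g : ℂ) • w) ∨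
      ∃ (V : N →* ℂˣ) (w : W), V ≠ 1 ∧ w ≠ 0 ∧ ∀ n : N, ρ n w = (V n : ℂ) • w := by
  let _ : CommGroup N := { (inferInstance : Group N) with mul_comm := hc }
  obtain ⟨V, w, hw, h⟩ := exists_common_eigenvector (ρ.comp N.subtype)
  by_cases hV : V = 1
  · left
    subst hV
    have hcard : Nat.card (G ⧸ N) = p := hN
    have : Finite (G ⧸ N) := Nat.finite_of_card_ne_zero (by rw [hcard]; exact hp.ne_zero)
    have := Fact.mk hp
    have : IsCyclic (G ⧸ N) := isCyclic_of_prime_card hcard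
    let _ : CommGroup (G ⧸ N) := IsCyclic.commGroup
    -- The N-invariants are non-zero and carry a representation of the cyclic group G/N, where a
    -- common eigenvector exists.
    have hwi : w ∈ Representation.invariants (ρ.comp N.subtype) := fun n => by simpa using h n
    have : Nontrivial (Representation.invariants (ρ.comp N.subtype)) :=
      ⟨⟨w, hwi⟩, 0, fun e => hw (congrArg Subtype.val e)⟩
    obtain ⟨χ, u, hu, hχ⟩ := exists_common_eigenvector (ρ.quotientToInvariants N)
    refine ⟨χ.comp (QuotientGroup.mk' N), u, fun n hn => ?_, fun e => hu (Subtype.ext e),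
      fun g => ?_⟩
    · rw [MonoidHom.mem_ker, MonoidHom.comp_apply, QuotientGroup.mk'_apply,
        (QuotientGroup.eq_one_iff n).2 hn, map_one]
    · exact congrArg Subtype.val (hχ g)
  · exact Or.inr ⟨V, w, hV, hw, h⟩

lemma IsInducedFrom.finrank_indChar [N.FiniteIndex] {V : N →* ℂˣ} (hV : IsFree V) :
    Module.finrank ℂ (indChar V) = N.index :=
  (isInducedFrom_ind V).finrank_eq hV

/-- If `v` is an eigenvector of `N` with character `V`, then some translate of `v` is an eigenvector
with a given conjugate character. -/
lemma apply_inv_eq_of_conjHom {k : Type} [Field k] {W : Type} [AddCommGroup W] [Module k W]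
    {ρ : Representation k G W} {V U : N →* kˣ} {v : W} {g : G} (hU : U = conjHom g V)
    (h : ∀ n : N, ρ n v = (U n : k) • v) (n : N) : ρ n (ρ g⁻¹ v) = (V n : k) • ρ g⁻¹ v := by
  rw [apply_apply_eq h g⁻¹ n, hU, ← conjHom_mul, inv_mul_cancel, conjHom_one]

lemma IsInducedFrom.exists_equiv_of_conjHom {k : Type} [Field k] {W W' : Type} [AddCommGroup W]
    [Module k W] [AddCommGroup W'] [Module k W'] {ρ : Representation k G W}
    {ρ' : Representation k G W'} {V U : N →* kˣ} {v : W} {v' : W'} (h : IsInducedFrom ρ V v)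
    (hV : IsFree V) (h' : IsInducedFrom ρ' U v') {g : G} (hU : U = conjHom g V) :
    Nonempty (ρ'.Equiv ρ) := by
  have h'' : IsInducedFrom ρ' V (ρ' g⁻¹ v') :=
    { ne_zero := apply_ne_zero ρ' h'.ne_zero _
      apply_eq := apply_inv_eq_of_conjHom hU h'.apply_eq
      span_eq := by
        rw [← h'.span_eq]
        congr 1
        ext w
        constructor
        · rintro ⟨y, rfl⟩
          exact ⟨y * g⁻¹, by simp⟩
        · rintro ⟨y, rfl⟩
          refine ⟨y * g, ?_⟩
          simp only [← Module.End.mul_apply, ← map_mul, mul_inv_cancel_right] }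
  exact h''.exists_equiv hV h

lemma IsInducedFrom.exists_conjHom_of_equiv {k : Type} [Field k] {W W' : Type} [AddCommGroup W]
    [Module k W] [AddCommGroup W'] [Module k W'] {ρ : Representation k G W}
    {ρ' : Representation k G W'} {V U : N →* kˣ} {v : W} {v' : W'} (h : IsInducedFrom ρ V v)
    (h' : IsInducedFrom ρ' U v') (hU : IsFree U) (e : ρ.Equiv ρ') : ∃ g : G, V = conjHom g U := by
  refine h'.exists_conjHom_eq hU (w := e.toLinearEquiv v)
    (fun h0 => h.ne_zero (e.toLinearEquiv.map_eq_zero_iff.1 h0)) fun n => ?_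
  rw [← equiv_apply, h.apply_eq, map_smul]

/-- Clifford theory with free orbits. The two families differ in degree, 1 against p; in the second,
the N-characters of an induced representation form exactly one orbit. Any irreducible representation
contains an eigenvector, which generates it. -/
theorem isCompleteIrrepList_complex [Finite N] (hp : p.Prime) (hN : N.index = p)
    (hc : ∀ a b : N, a * b = b * a) (hfree : ∀ V : N →* ℂˣ, V ≠ 1 → IsFree V)
    {ι κ : Type} {χ : κ → (G →* ℂˣ)} (hχ : Function.Injective χ)
    (hχr : Set.range χ = {ψ | N ≤ ψ.ker}) {V : ι → (N →* ℂˣ)} (hV : IsCharOrbitReps V) :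
    IsCompleteIrrepList
      (Sum.elim (fun i => Rep.of (charRep (χ i))) fun j => indChar (V j)) := by
  have : N.FiniteIndex := ⟨by rw [hN]; exact hp.ne_zero⟩
  have hdim : ∀ i j, ¬ Nonempty ((charRep (χ i)).Equiv (indChar (V j)).ρ) := by
    rintro i j ⟨e⟩
    have h1 := e.toLinearEquiv.finrank_eq
    rw [IsInducedFrom.finrank_indChar (hfree _ (hV.1 j)), hN, Module.finrank_self] at h1
    exact hp.one_lt.ne h1
  refine ⟨?_, ?_, ?_⟩
  · rintro (i | j)
    · exact charRep_isIrreducible _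
    · exact (isInducedFrom_ind (V j)).isIrreducible (hfree _ (hV.1 j))
  · rintro (i | i) (j | j) ⟨e⟩
    · exact congrArg Sum.inl (hχ (eq_of_charRep_equiv ⟨e⟩))
    · exact absurd ⟨e⟩ (hdim i j)
    · exact absurd ⟨e.symm⟩ (hdim j i)
    · obtain ⟨g, hg⟩ := (isInducedFrom_ind (V i)).exists_conjHom_of_equiv
        (isInducedFrom_ind (V j)) (hfree _ (hV.1 j)) e
      refine congrArg Sum.inr ((hV.2 (V i) (hV.1 i)).unique ⟨1, fun n => ?_⟩
        ⟨g, fun n => by rw [hg]; rfl⟩)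
      simp
  · intro W _ _ ρ hρ
    have := nontrivial_of_isIrreducible hρ
    rcases exists_eigenvector hp hN hc ρ with ⟨ψ, w, hψ, hw, h⟩ | ⟨U, w, hU, hw, h⟩
    · obtain ⟨i, rfl⟩ : ψ ∈ Set.range χ := hχr ▸ hψ
      exact ⟨Sum.inl i, nonempty_equiv_charRep hρ hw h⟩
    · obtain ⟨j, ⟨g, hg⟩, -⟩ := hV.2 U hU
      refine ⟨Sum.inr j, ?_⟩
      exact (isInducedFrom_ind (V j)).exists_equiv_of_conjHom (hfree _ (hV.1 j))
        (IsInducedFrom.of_isIrreducible hρ hw h) (g := g) (MonoidHom.ext hg)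

end Complex

/-! ### Counting orbits of characters. -/

section Count

/-- All stabilizers equal N, so every orbit has p elements and there are m orbits. -/
lemma exists_orbit_reps {G X : Type} [Group G] [MulAction G X] [Finite X] {N : Subgroup G}
    (hst : ∀ x : X, MulAction.stabilizer G x = N) {p m : ℕ} (hp : 0 < p) (hN : N.index = p)
    (hm : Nat.card X = m * p) : ∃ L : Fin m → X, ∀ x, ∃! j, ∃ g : G, x = g • L j := by
  classical
  have e := MulAction.selfEquivSigmaOrbitsQuotientStabilizer G X
  have := Fintype.ofFinite (MulAction.orbitRel.Quotient G X)
  have hcard : Nat.card (MulAction.orbitRel.Quotient G X) = m := by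
    have : ∀ ω : MulAction.orbitRel.Quotient G X,
        Finite (G ⧸ MulAction.stabilizer G (Quotient.out ω)) := fun ω =>
      Nat.finite_of_card_ne_zero (by
        rw [hst, ← Subgroup.index, hN]; exact hp.ne')
    have h1 := Nat.card_congr e
    have h2 : ∀ ω : MulAction.orbitRel.Quotient G X,
        Nat.card (G ⧸ MulAction.stabilizer G (Quotient.out ω)) = p := fun ω => by
      rw [hst, ← Subgroup.index, hN]
    rw [Nat.card_sigma, hm, Finset.sum_congr rfl fun ω _ => h2 ω, Finset.sum_const, smul_eq_mul,
      Finset.card_univ] at h1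
    rw [Nat.card_eq_fintype_card]
    exact (Nat.eq_of_mul_eq_mul_right hp h1).symm
  let f : Fin m ≃ MulAction.orbitRel.Quotient G X := (Finite.equivFinOfCardEq hcard).symm
  refine ⟨fun j => (f j).out, fun x => ⟨f.symm (Quotient.mk'' x), ?_, ?_⟩⟩
  · have h1 : MulAction.orbitRel G X x (Quotient.mk'' x : MulAction.orbitRel.Quotient G X).out :=
      Quotient.exact (Quotient.out_eq _).symm
    obtain ⟨g, hg⟩ := h1
    refine ⟨g, ?_⟩
    simp only [Equiv.apply_symm_apply]
    exact hg.symm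
  · rintro j ⟨g, hg⟩
    rw [Equiv.eq_symm_apply, ← Quotient.out_eq (f j)]
    refine Quotient.sound ?_
    exact ⟨g⁻¹, by simp only [hg]; exact inv_smul_smul _ _⟩

variable {G : Type} [Group G] {N : Subgroup G} [N.Normal] {p q : ℕ}

/-- The conjugation action on the non-trivial characters. -/
@[reducible] def charAction (N : Subgroup G) [N.Normal] : MulAction G {V : N →* ℂˣ // V ≠ 1} where
  smul g V := ⟨conjHom g V.1, fun h => V.2 (conjHom_eq_one_iff.1 h)⟩
  one_smul V := Subtype.ext (conjHom_one V.1)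
  mul_smul g h V := Subtype.ext (conjHom_mul g h V.1)

lemma exists_charOrbitReps (hp : p.Prime) (hN : N.index = p) (hc : ∀ a b : N, a * b = b * a)
    (hfree : ∀ V : N →* ℂˣ, V ≠ 1 → IsFree V) [Finite (N →* ℂˣ)] {m : ℕ}
    (hm : Nat.card (N →* ℂˣ) = m * p + 1) : ∃ V : Fin m → (N →* ℂˣ), IsCharOrbitReps V := by
  let _ := charAction N
  have hm' : Nat.card {V : N →* ℂˣ // V ≠ 1} = m * p := by
    classical
    have := Fintype.ofFinite (N →* ℂˣ)
    rw [Nat.card_eq_fintype_card, Fintype.card_subtype_compl, Fintype.card_subtype_eq,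
      ← Nat.card_eq_fintype_card, hm, Nat.add_sub_cancel]
  obtain ⟨L, hL⟩ := exists_orbit_reps (X := {V : N →* ℂˣ // V ≠ 1}) (N := N) (fun V => by
    ext g
    rw [MulAction.mem_stabilizer_iff]
    refine ⟨fun h => hfree _ V.2 g (congrArg Subtype.val h), fun h => Subtype.ext ?_⟩
    exact conjHom_of_mem hc h V.1) hp.pos hN hm'
  refine ⟨fun j => (L j).1, fun j => (L j).2, fun W hW => ?_⟩
  obtain ⟨j, ⟨g, hg⟩, hj⟩ := hL ⟨W, hW⟩
  refine ⟨j, ⟨g, fun n => DFunLike.congr_fun (congrArg Subtype.val hg) n⟩, ?_⟩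
  rintro j' ⟨g', hg'⟩
  exact hj j' ⟨g', Subtype.ext (MonoidHom.ext hg')⟩

end Count

/-! ### Characters and maximal subgroups of a group of prime exponent. -/

section PrimeExponent

variable {N : Type} [Group N] {q : ℕ}

lemma exists_eq_pow_of_pow_eq_one (hq : q.Prime) {z w : ℂˣ} (hz : z ^ q = 1) (hw : w ^ q = 1)
    (hz1 : z ≠ 1) : ∃ a : ℕ, w = z ^ a := by
  have := Fact.mk hq
  have : NeZero q := ⟨hq.ne_zero⟩
  obtain ⟨a, ha⟩ := mem_powers_of_prime_card (G := rootsOfUnity q ℂ) (Complex.card_rootsOfUnity q)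
    (g := ⟨z, hz⟩) (g' := ⟨w, hw⟩) fun h => hz1 (congrArg Subtype.val h)
  exact ⟨a, (congrArg Subtype.val ha).symm⟩

lemma map_pow_eq_one (hexp : ∀ n : N, n ^ q = 1) (V : N →* ℂˣ) (n : N) : V n ^ q = 1 := by
  rw [← map_pow, hexp, map_one]

lemma exists_apply_ne_one {V : N →* ℂˣ} (hV : V ≠ 1) : ∃ n, V n ≠ 1 := by
  by_contra! h
  exact hV (MonoidHom.ext h)

lemma isCoatom_ker (hq : q.Prime) (hexp : ∀ n : N, n ^ q = 1) {V : N →* ℂˣ} (hV : V ≠ 1) :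
    IsCoatom V.ker := by
  refine ⟨fun h => ?_, fun K hK => ?_⟩
  · obtain ⟨n, hn⟩ := exists_apply_ne_one hV
    exact hn (by rw [← MonoidHom.mem_ker, h]; trivial)
  · obtain ⟨hle, n0, hn0, hn0'⟩ := SetLike.lt_iff_le_and_exists.1 hK
    rw [eq_top_iff]
    intro n _
    obtain ⟨a, ha⟩ := exists_eq_pow_of_pow_eq_one hq (map_pow_eq_one hexp V n0)
      (map_pow_eq_one hexp V n) hn0'
    have h1 : n * (n0 ^ a)⁻¹ ∈ K := hle (by
      rw [MonoidHom.mem_ker, map_mul, map_inv, map_pow, ha, mul_inv_cancel])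
    simpa using mul_mem h1 (pow_mem hn0 a)

/-- Some character is trivial on M but not at a chosen element outside M; by maximality its kernel
is M. -/
lemma exists_ker_eq [Finite N] (hc : ∀ a b : N, a * b = b * a) {M : Subgroup N}
    (hM : IsCoatom M) : ∃ V : N →* ℂˣ, V.ker = M := by
  let _ : CommGroup N := { (inferInstance : Group N) with mul_comm := hc }
  obtain ⟨x, -, hx⟩ := SetLike.lt_iff_le_and_exists.1 (lt_top_iff_ne_top.2 hM.1) |>.2
  have h1 := (CommGroup.forall_monoidHom_apply_eq_one_iff ℂ M x).not.2 hx
  push Not at h1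
  obtain ⟨φ, hφ, hφx⟩ := h1
  refine ⟨φ, by_contra fun hne => ?_⟩
  have hle : M ≤ φ.ker := hφ
  have := hM.2 _ (lt_of_le_of_ne hle (Ne.symm hne))
  exact hφx (by rw [← MonoidHom.mem_ker, this]; trivial)

lemma ne_one_of_isCoatom_ker {V : N →* ℂˣ} (h : IsCoatom V.ker) : V ≠ 1 := by
  rintro rfl
  exact h.1 (MonoidHom.ker_one)

/-- Both characters factor through N/ker V, which V embeds in μ_q. An element on which V is
non-trivial generates this quotient, so the exponent can be read off there. -/
lemma exists_eq_pow_of_ker_eq (hq : q.Prime) (hexp : ∀ n : N, n ^ q = 1) {U V : N →* ℂˣ}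
    (hV : V ≠ 1) (h : V.ker ≤ U.ker) : ∃ a : ℕ, U = V ^ a := by
  obtain ⟨n0, hn0⟩ := exists_apply_ne_one hV
  obtain ⟨a, ha⟩ := exists_eq_pow_of_pow_eq_one hq (map_pow_eq_one hexp V n0)
    (map_pow_eq_one hexp U n0) hn0
  refine ⟨a, MonoidHom.ext fun n => ?_⟩
  obtain ⟨b, hb⟩ := exists_eq_pow_of_pow_eq_one hq (map_pow_eq_one hexp V n0)
    (map_pow_eq_one hexp V n) hn0
  have h1 : n * (n0 ^ b)⁻¹ ∈ U.ker := h (by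
    rw [MonoidHom.mem_ker, map_mul, map_inv, map_pow, hb, mul_inv_cancel])
  rw [MonoidHom.mem_ker, map_mul, map_inv, map_pow, mul_inv_eq_one] at h1
  rw [MonoidHom.pow_apply, h1, ha, hb, ← pow_mul, ← pow_mul, mul_comm]

lemma pow_exponent_eq_one (hexp : ∀ n : N, n ^ q = 1) (V : N →* ℂˣ) : V ^ q = 1 :=
  MonoidHom.ext fun n => map_pow_eq_one hexp V n

lemma orderOf_char (hq : q.Prime) (hexp : ∀ n : N, n ^ q = 1) {V : N →* ℂˣ} (hV : V ≠ 1) :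
    orderOf V = q := by
  have := Fact.mk hq
  exact orderOf_eq_prime (pow_exponent_eq_one hexp V) hV

lemma card_ker_eq (hq : q.Prime) (hexp : ∀ n : N, n ^ q = 1) {V : N →* ℂˣ} (hV : V ≠ 1) :
    Nat.card {U : N →* ℂˣ // U ≠ 1 ∧ U.ker = V.ker} = q - 1 := by
  classical
  have h1 : {U : N →* ℂˣ | U ≠ 1 ∧ U.ker = V.ker} = (Subgroup.zpowers V : Set _) \ {1} := by
    ext U
    simp only [Set.mem_ofPred_eq, Set.mem_sdiff, SetLike.mem_coe, Set.mem_singleton_iff]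
    constructor
    · rintro ⟨h1, h2⟩
      obtain ⟨a, rfl⟩ := exists_eq_pow_of_ker_eq hq hexp hV h2.ge
      exact ⟨Subgroup.npow_mem_zpowers _ _, h1⟩
    · rintro ⟨⟨a, rfl⟩, h1⟩
      refine ⟨h1, ((isCoatom_ker hq hexp hV).le_iff_eq
        (isCoatom_ker hq hexp h1).1).1 fun n hn => ?_⟩
      change (V n) ^ a = 1
      rw [MonoidHom.mem_ker.1 hn, one_zpow]
  have h2 : Nat.card (Subgroup.zpowers V) = q := by
    rw [Nat.card_zpowers, orderOf_char hq hexp hV]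
  have : Finite (Subgroup.zpowers V) := Nat.finite_of_card_ne_zero (h2 ▸ hq.ne_zero)
  have h3 : (Subgroup.zpowers V : Set (N →* ℂˣ)).Finite := Set.toFinite _
  change Nat.card {U : N →* ℂˣ | U ≠ 1 ∧ U.ker = V.ker} = q - 1
  rw [h1, Nat.card_coe_set_eq, Set.ncard_sdiff_singleton_of_mem (one_mem _), ← Nat.card_coe_set_eq]
  exact congrArg (· - 1) h2

/-- The map sending a non-trivial character to its kernel is onto the maximal subgroups, and each
fibre consists of the q - 1 non-trivial powers of one character. -/
lemma card_isCoatom [Finite N] (hq : q.Prime) (hc : ∀ a b : N, a * b = b * a)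
    (hexp : ∀ n : N, n ^ q = 1) [Finite (N →* ℂˣ)] :
    Nat.card (N →* ℂˣ) = Nat.card {M : Subgroup N // IsCoatom M} * (q - 1) + 1 := by
  classical
  have := Fintype.ofFinite (N →* ℂˣ)
  have : Fintype {M : Subgroup N // IsCoatom M} := Fintype.ofFinite _
  let f : {V : N →* ℂˣ // V ≠ 1} → {M : Subgroup N // IsCoatom M} := fun V =>
    ⟨V.1.ker, isCoatom_ker hq hexp V.2⟩
  have h1 := Nat.card_congr (Equiv.sigmaFiberEquiv f)
  have h2 : ∀ M, Nat.card {V // f V = M} = q - 1 := fun M => by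
    obtain ⟨V, hV⟩ := exists_ker_eq hc M.2
    have hV1 : V ≠ 1 := ne_one_of_isCoatom_ker (hV ▸ M.2)
    rw [← card_ker_eq hq hexp hV1]
    refine Nat.card_congr ((Equiv.subtypeSubtypeEquivSubtypeInter _ _).symm.trans ?_).symm
    exact Equiv.subtypeEquivRight fun U => by rw [hV]; simp [f, Subtype.ext_iff]
  rw [Nat.card_sigma, Finset.sum_congr rfl fun M _ => h2 M, Finset.sum_const, smul_eq_mul,
    Finset.card_univ, ← Nat.card_eq_fintype_card] at h1
  rw [h1, Nat.card_eq_fintype_card (α := {V : N →* ℂˣ // V ≠ 1}), Fintype.card_subtype_compl,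
    Fintype.card_subtype_eq, Nat.card_eq_fintype_card]
  exact (Nat.sub_add_cancel Fintype.card_pos).symm

end PrimeExponent

/-! ### Conjugation of maximal subgroups. -/

section Conj

variable {G : Type} [Group G] {N : Subgroup G} [N.Normal] {p q : ℕ}

lemma ker_conjHom {M : Type} [Group M] (g : G) (V : N →* M) :
    (conjHom g V).ker = V.ker.map (MulAut.conjNormal g : MulAut N).toMonoidHom := by
  ext n
  rw [Subgroup.mem_map]
  constructor
  · intro h
    exact ⟨MulAut.conjNormal g⁻¹ n, h, by simp⟩
  · rintro ⟨m, hm, rfl⟩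
    rw [MonoidHom.mem_ker, conjHom_apply]
    simpa using hm

lemma conjHom_pow (g : G) (V : N →* ℂˣ) (a : ℕ) : conjHom g (V ^ a) = conjHom g V ^ a := rfl

/-- Equal kernels force `conjHom g V = V ^ a`. As `g ^ p` lies in N, iterating gives a^p = 1 mod q;
Fermat gives a^(q-1) = 1, and coprimality leaves a = 1. Then g fixes V, and freeness applies. -/
lemma mem_of_ker_conjHom_eq (hp : p.Prime) (hN : N.index = p) (hq : q.Prime)
    (hcop : Nat.Coprime p (q - 1)) (hc : ∀ a b : N, a * b = b * a) (hexp : ∀ n : N, n ^ q = 1)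
    (hfree : ∀ V : N →* ℂˣ, V ≠ 1 → IsFree V) {V : N →* ℂˣ} (hV : V ≠ 1) {g : G}
    (h : (conjHom g V).ker = V.ker) : g ∈ N := by
  refine hfree V hV g ?_
  obtain ⟨a, ha⟩ := exists_eq_pow_of_ker_eq hq hexp hV h.ge
  have hpow : ∀ k : ℕ, conjHom (g ^ k) V = V ^ a ^ k := by
    intro k
    induction k with
    | zero => exact MonoidHom.ext fun n => by simp [conjHom_one]
    | succ k ih =>
      rw [pow_succ, conjHom_mul, ha, conjHom_pow, ih]
      exact MonoidHom.ext fun n => by simp [pow_succ, pow_mul]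
  have hgp : g ^ p ∈ N := by
    rw [← hN, Subgroup.index_eq_card, ← QuotientGroup.eq_one_iff, QuotientGroup.mk_pow,
      pow_card_eq_one']
  have h1 : V ^ a ^ p = V := by rw [← hpow, conjHom_of_mem hc hgp]
  have := Fact.mk hq
  have h2 : ((a : ZMod q)) ^ p = 1 := by
    have : a ^ p ≡ 1 [MOD q] := by
      obtain ⟨n, hn⟩ := exists_apply_ne_one hV
      have h2 : V n ^ a ^ p = V n ^ 1 := by
        rw [pow_one]; exact DFunLike.congr_fun h1 n
      rwa [pow_eq_pow_iff_modEq, orderOf_eq_prime (map_pow_eq_one hexp V n) hn] at h2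
    have := (ZMod.natCast_eq_natCast_iff _ _ _).2 this
    simpa using this
  have h3 : (a : ZMod q) ≠ 0 := by
    intro e
    rw [e, zero_pow hp.ne_zero] at h2
    exact zero_ne_one h2
  have h4 : (a : ZMod q) = 1 := by
    have := pow_gcd_eq_one.2 ⟨h2, ZMod.pow_card_sub_one_eq_one h3⟩
    rwa [hcop, pow_one] at this
  have h5 : a ≡ 1 [MOD q] := (ZMod.natCast_eq_natCast_iff _ _ _).1 (by simpa using h4)
  rw [ha]
  refine MonoidHom.ext fun n => ?_
  have := pow_eq_pow_of_modEq h5 (map_pow_eq_one hexp V n)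
  rwa [pow_one] at this

/-- The conjugation action on the maximal subgroups. -/
@[reducible] def coatomAction (N : Subgroup G) [N.Normal] :
    MulAction G {M : Subgroup N // IsCoatom M} where
  smul g M := ⟨M.1.map (MulAut.conjNormal g : MulAut N).toMonoidHom,
    ((MulAut.conjNormal g : MulAut N).mapSubgroup.isCoatom_iff _).2 M.2⟩
  one_smul M := Subtype.ext (by
    change M.1.map (MulAut.conjNormal 1 : MulAut N).toMonoidHom = M.1
    rw [map_one]
    exact Subgroup.map_id _)
  mul_smul g h M := Subtype.ext (by
    change M.1.map (MulAut.conjNormal (g * h) : MulAut N).toMonoidHom =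
      (M.1.map (MulAut.conjNormal h : MulAut N).toMonoidHom).map
        (MulAut.conjNormal g : MulAut N).toMonoidHom
    rw [map_mul, Subgroup.map_map]
    rfl)

lemma exists_maximalOrbitReps (hp : p.Prime) (hN : N.index = p) (hq : q.Prime)
    (hcop : Nat.Coprime p (q - 1)) (hc : ∀ a b : N, a * b = b * a) (hexp : ∀ n : N, n ^ q = 1)
    (hfree : ∀ V : N →* ℂˣ, V ≠ 1 → IsFree V) [Finite N] [Finite (N →* ℂˣ)] {m : ℕ}
    (hm : Nat.card (N →* ℂˣ) = m * (p * (q - 1)) + 1) :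
    ∃ L : Fin m → Subgroup N, IsMaximalOrbitReps L := by
  let _ := coatomAction N
  have hm' : Nat.card {M : Subgroup N // IsCoatom M} = m * p := by
    have h1 := card_isCoatom hq hc hexp
    rw [hm, ← mul_assoc] at h1
    exact (Nat.eq_of_mul_eq_mul_right (Nat.sub_pos_of_lt hq.one_lt) (Nat.succ_injective h1)).symm
  have hsmul : ∀ (g : G) (M : {M : Subgroup N // IsCoatom M}), (g • M).1 =
    M.1.map (MulAut.conjNormal g : MulAut N).toMonoidHom := fun _ _ => rfl
  obtain ⟨L, hL⟩ := exists_orbit_reps (X := {M : Subgroup N // IsCoatom M}) (N := N) (fun M => by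
    obtain ⟨V, hV⟩ := exists_ker_eq hc M.2
    have hV1 : V ≠ 1 := ne_one_of_isCoatom_ker (hV ▸ M.2)
    ext g
    rw [MulAction.mem_stabilizer_iff, Subtype.ext_iff, hsmul, ← hV, ← ker_conjHom]
    exact ⟨mem_of_ker_conjHom_eq hp hN hq hcop hc hexp hfree hV1, fun h => by
      rw [conjHom_of_mem hc h]⟩) hp.pos hN hm'
  refine ⟨fun j => (L j).1, fun j => (L j).2, fun M hM => ?_⟩
  obtain ⟨j, ⟨g, hg⟩, hj⟩ := hL ⟨M, hM⟩
  refine ⟨j, ⟨g, congrArg Subtype.val hg⟩, ?_⟩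
  rintro j' ⟨g', hg'⟩
  exact hj j' ⟨g', Subtype.ext hg'⟩

end Conj

/-! ### The cyclotomic field and its automorphisms. -/

section Cyclotomic

variable {m : ℕ}

/-- The primitive root of unity `exp (2πi/m)` in the cyclotomic field. -/
def cycloRoot (m : ℕ) : cyclotomicSubfield m :=
  ⟨Complex.exp (2 * Real.pi * Complex.I / m), IntermediateField.mem_adjoin_simple_self ℚ _⟩

lemma isPrimitiveRoot_cycloRoot (hm : m ≠ 0) : IsPrimitiveRoot (cycloRoot m) m :=
  IsPrimitiveRoot.of_map_of_injective (f := algebraMap (cyclotomicSubfield m) ℂ)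
    (Complex.isPrimitiveRoot_exp m hm) (algebraMap (cyclotomicSubfield m) ℂ).injective

instance isCyclotomicExtension_cyclotomicSubfield [NeZero m] :
    IsCyclotomicExtension {m} ℚ (cyclotomicSubfield m) := by
  have h := Complex.isPrimitiveRoot_exp m (NeZero.ne m)
  have h1 := h.adjoin_isCyclotomicExtension ℚ
  have h2 : (cyclotomicSubfield m).toSubalgebra =
      Algebra.adjoin ℚ {Complex.exp (2 * Real.pi * Complex.I / m)} :=
    IntermediateField.adjoin_simple_toSubalgebra_of_isAlgebraic
      (h.isIntegral (NeZero.pos m)).tower_top.isAlgebraic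
  exact IsCyclotomicExtension.equiv {m} ℚ _ (Subalgebra.equivOfEq _ _ h2.symm)

instance finiteDimensional_cyclotomicSubfield [NeZero m] :
    FiniteDimensional ℚ (cyclotomicSubfield m) :=
  IsCyclotomicExtension.finiteDimensional {m} ℚ _

instance isGalois_cyclotomicSubfield [NeZero m] : IsGalois ℚ (cyclotomicSubfield m) :=
  IsCyclotomicExtension.isGalois {m} ℚ _

lemma finrank_cyclotomicSubfield (hm : m.Prime) :
    Module.finrank ℚ (cyclotomicSubfield m) = m - 1 := by
  have : NeZero m := ⟨hm.ne_zero⟩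
  rw [IsCyclotomicExtension.finrank (n := m) _ (Polynomial.cyclotomic.irreducible_rat hm.pos),
    Nat.totient_prime hm]

lemma exists_aut_apply_cycloRoot [NeZero m] {μ : cyclotomicSubfield m} (hμ : IsPrimitiveRoot μ m) :
    ∃ σ : cyclotomicSubfield m ≃ₐ[ℚ] cyclotomicSubfield m, σ (cycloRoot m) = μ := by
  have hirr := Polynomial.cyclotomic.irreducible_rat (NeZero.pos m)
  have key : ∀ {ν : cyclotomicSubfield m}, IsPrimitiveRoot ν m →
      ∃ σ : cyclotomicSubfield m ≃ₐ[ℚ] cyclotomicSubfield m,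
        σ (IsCyclotomicExtension.zeta m ℚ (cyclotomicSubfield m)) = ν := fun hν =>
    ⟨_, IsCyclotomicExtension.fromZetaAut_spec hν hirr⟩
  obtain ⟨σ, hσ⟩ := key (isPrimitiveRoot_cycloRoot (NeZero.ne m))
  obtain ⟨τ, hτ⟩ := key hμ
  refine ⟨σ.symm.trans τ, ?_⟩
  rw [AlgEquiv.trans_apply, ← hσ, AlgEquiv.symm_apply_apply, hτ]

lemma aut_ext [NeZero m] {σ τ : cyclotomicSubfield m ≃ₐ[ℚ] cyclotomicSubfield m}
    (h : σ (cycloRoot m) = τ (cycloRoot m)) : σ = τ := by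
  have htop := IsCyclotomicExtension.adjoin_primitive_root_eq_top (A := ℚ)
    (isPrimitiveRoot_cycloRoot (NeZero.ne m))
  have : σ.toAlgHom = τ.toAlgHom := AlgHom.ext_of_adjoin_eq_top htop (by
    rintro _ rfl
    exact h)
  exact AlgEquiv.ext fun x => DFunLike.congr_fun this x

/-- A non-zero rational subspace of the cyclotomic field which is stable under the multiplication by
the primitive root is everything. -/
lemma mem_of_cycloRoot_mul_mem [NeZero m] (S : Submodule ℚ (cyclotomicSubfield m))
    (hS : ∀ x ∈ S, cycloRoot m * x ∈ S) {a : cyclotomicSubfield m} (ha : a ∈ S) (ha0 : a ≠ 0)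
    (b : cyclotomicSubfield m) : b ∈ S := by
  -- The multipliers preserving S form a subalgebra containing the primitive root, hence the whole
  -- field; in particular `b * a⁻¹` carries `a` to `b` inside S.
  let T : Subalgebra ℚ (cyclotomicSubfield m) :=
    { carrier := {x | ∀ y ∈ S, x * y ∈ S}
      mul_mem' := fun {x y} hx hy z hz => by rw [mul_assoc]; exact hx _ (hy _ hz)
      add_mem' := fun {x y} hx hy z hz => by rw [add_mul]; exact S.add_mem (hx _ hz) (hy _ hz)
      algebraMap_mem' := fun r z hz => by rw [← Algebra.smul_def]; exact S.smul_mem _ hz }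
  have htop := IsCyclotomicExtension.adjoin_primitive_root_eq_top (A := ℚ)
    (isPrimitiveRoot_cycloRoot (NeZero.ne m))
  have hT : Algebra.adjoin ℚ {cycloRoot m} ≤ T := Algebra.adjoin_le (by
    rintro _ rfl
    exact hS)
  rw [htop] at hT
  have := hT (Algebra.mem_top (x := b * a⁻¹)) a ha
  rwa [inv_mul_cancel_right₀ ha0] at this

/-- The composite of an automorphism of the cyclotomic field with the inclusion into `ℂ`. -/
def embedding (σ : cyclotomicSubfield m ≃ₐ[ℚ] cyclotomicSubfield m) : cyclotomicSubfield m →+* ℂ :=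
  (algebraMap (cyclotomicSubfield m) ℂ).comp (σ : cyclotomicSubfield m →+* cyclotomicSubfield m)

end Cyclotomic

/-! ### Matrix forms, restriction of scalars and complexification. -/

section MatrixRep

variable {G : Type} [Group G]

lemma exists_matrixRep_equiv {k : Type} [Field k] {n : ℕ} {W : Type} [AddCommGroup W] [Module k W]
    (ρ : Representation k G W) (b : Module.Basis (Fin n) k W) :
    ∃ A : G →* GL (Fin n) k, Nonempty (ρ.Equiv (matrixRep A)) := by
  refine ⟨(Units.map (LinearMap.toMatrixAlgEquiv b).toMonoidHom).comp ρ.toHomUnits,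
    ⟨Representation.Equiv.mk b.equivFun fun g => LinearMap.ext fun w => ?_⟩⟩
  exact (LinearMap.toMatrix_mulVec_repr b b (ρ g) w).symm

/-- The representation given by applying a ring homomorphism to the entries of the matrices. -/
lemma matrixRep_map_apply {K k : Type} [Field K] [Field k] (φ : K →+* k) {n : ℕ}
    (A : G →* GL (Fin n) K) (g : G) (v : Fin n → K) :
    matrixRep ((Matrix.GeneralLinearGroup.map φ).comp A) g (φ ∘ v) = φ ∘ matrixRep A g v :=
  funext fun i => (RingHom.map_mulVec φ (A g : Matrix (Fin n) (Fin n) K) v i).symm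

/-- The rational representation obtained by restriction of scalars. -/
def ratRep {K : Type} [Field K] [Algebra ℚ K] {n : ℕ} (A : G →* GL (Fin n) K) :
    Representation ℚ G (Fin n → K) where
  toFun g := (matrixRep A g).restrictScalars ℚ
  map_one' := by ext; simp
  map_mul' g h := by ext; simp

lemma ratRep_apply {K : Type} [Field K] [Algebra ℚ K] {n : ℕ} (A : G →* GL (Fin n) K) (g : G)
    (v : Fin n → K) : ratRep A g v = matrixRep A g v := rfl

lemma complexify_tmul {W : Type} [AddCommGroup W] [Module ℚ W] (ρ : Representation ℚ G W) (g : G)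
    (z : ℂ) (w : W) : complexify ρ g (z ⊗ₜ w) = z ⊗ₜ ρ g w := rfl

variable {m : ℕ}

/-- The coordinatewise conjugates of a vector. -/
def conjVec (m n : ℕ) : (Fin n → cyclotomicSubfield m) →ₗ[ℚ]
    ((cyclotomicSubfield m ≃ₐ[ℚ] cyclotomicSubfield m) → Fin n → ℂ) where
  toFun v σ i := embedding σ (v i)
  map_add' v w := by ext; simp
  map_smul' c v := by ext σ i; simp [embedding, Algebra.smul_def]

/-- A linear form vanishing on the image yields, for each coordinate, a linear relation between the
embeddings of K in ℂ; Dedekind's independence of characters makes its coefficients zero. -/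
lemma conjVec_baseChange_surjective [NeZero m] (n : ℕ) :
    Function.Surjective (LinearMap.liftBaseChange ℂ (conjVec m n)) := by
  classical
  rw [← LinearMap.range_eq_top]
  by_contra hne
  obtain ⟨f, hf0, hf⟩ := Submodule.exists_le_ker_of_lt_top _ (lt_top_iff_ne_top.2 hne)
  have := Fintype.ofFinite (cyclotomicSubfield m ≃ₐ[ℚ] cyclotomicSubfield m)
  have key : ∀ v : Fin n → cyclotomicSubfield m, f (conjVec m n v) = 0 := fun v =>
    hf ⟨1 ⊗ₜ v, by rw [LinearMap.liftBaseChange_tmul, one_smul]⟩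
  refine hf0 ?_
  have hinj : Function.Injective fun σ : cyclotomicSubfield m ≃ₐ[ℚ] cyclotomicSubfield m =>
      (embedding σ : cyclotomicSubfield m →* ℂ) := fun σ τ h => by
    refine AlgEquiv.ext fun x => (algebraMap (cyclotomicSubfield m) ℂ).injective ?_
    simpa [embedding] using DFunLike.congr_fun h x
  have hlin := (linearIndependent_monoidHom (cyclotomicSubfield m) ℂ).comp _ hinj
  have hcoef : ∀ (i : Fin n) (σ : cyclotomicSubfield m ≃ₐ[ℚ] cyclotomicSubfield m),
      f (Pi.single σ (Pi.single i 1)) = 0 := by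
    intro i
    refine Fintype.linearIndependent_iff.1 hlin _ (funext fun x => ?_)
    have h1 := key (Pi.single i x)
    have h2 : conjVec m n (Pi.single i x) =
        ∑ σ, embedding σ x • Pi.single σ (Pi.single i (1 : ℂ)) := by
      ext σ j
      simp only [conjVec, LinearMap.coe_mk, AddHom.coe_mk, Finset.sum_apply, Pi.smul_apply,
        smul_eq_mul]
      rw [Finset.sum_eq_single σ]
      · by_cases h : j = i
        · subst h; simp
        · simp [h]
      · intro τ _ hτ
        simp [hτ.symm]
      · simp
    rw [h2, map_sum] at h1
    simp only [map_smul, smul_eq_mul] at h1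
    simpa [mul_comm] using h1
  refine LinearMap.pi_ext' fun σ => LinearMap.pi_ext' fun i => LinearMap.ext_ring ?_
  exact hcoef i σ

/-- The complexification of the restriction of scalars of a representation over the cyclotomic field
is the direct sum of its Galois conjugates. -/
lemma complexify_ratRep_equiv (hm : m.Prime) {n : ℕ} (A : G →* GL (Fin n) (cyclotomicSubfield m)) :
    Nonempty ((complexify (ratRep A)).Equiv (Representation.directSum
      fun σ : cyclotomicSubfield m ≃ₐ[ℚ] cyclotomicSubfield m =>
        matrixRep ((Matrix.GeneralLinearGroup.map (embedding σ)).comp A))) := by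
  have : NeZero m := ⟨hm.ne_zero⟩
  have := Fintype.ofFinite (cyclotomicSubfield m ≃ₐ[ℚ] cyclotomicSubfield m)
  have hdim : Module.finrank ℂ (TensorProduct ℚ ℂ (Fin n → cyclotomicSubfield m)) =
      Module.finrank ℂ ((cyclotomicSubfield m ≃ₐ[ℚ] cyclotomicSubfield m) → Fin n → ℂ) := by
    rw [Module.finrank_baseChange, Module.finrank_pi_fintype, Module.finrank_pi_fintype]
    simp only [Finset.sum_const, smul_eq_mul, Finset.card_univ, Fintype.card_fin,
      Module.finrank_fin_fun]
    rw [← IsGalois.card_aut_eq_finrank, Nat.card_eq_fintype_card, mul_comm]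
  let e := LinearEquiv.ofBijective (LinearMap.liftBaseChange ℂ (conjVec m n))
    ⟨(LinearMap.injective_iff_surjective_of_finrank_eq_finrank hdim).2
      (conjVec_baseChange_surjective n), conjVec_baseChange_surjective n⟩
  let d := DirectSum.linearEquivFunOnFintype ℂ
    (cyclotomicSubfield m ≃ₐ[ℚ] cyclotomicSubfield m) fun _ => Fin n → ℂ
  refine ⟨Representation.Equiv.mk (e.trans d.symm) fun g => ?_⟩
  refine TensorProduct.AlgebraTensorModule.ext fun z v => ?_
  refine d.injective (funext fun σ => ?_)
  have h1 : ∀ y, d (Representation.directSum (fun σ : cyclotomicSubfield m ≃ₐ[ℚ] cyclotomicSubfield m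
      => matrixRep ((Matrix.GeneralLinearGroup.map (embedding σ)).comp A)) g y) σ =
      matrixRep ((Matrix.GeneralLinearGroup.map (embedding σ)).comp A) g (d y σ) := fun y => rfl
  simp only [LinearMap.comp_apply, LinearEquiv.coe_coe, LinearEquiv.trans_apply, complexify_tmul,
    h1, LinearEquiv.apply_symm_apply]
  have he : ∀ y : Fin n → cyclotomicSubfield m, e (z ⊗ₜ y) σ = z • (embedding σ ∘ y) := fun y => by
    change LinearMap.liftBaseChange ℂ (conjVec m n) (z ⊗ₜ y) σ = _
    rw [LinearMap.liftBaseChange_tmul]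
    rfl
  rw [he, he, map_smul, matrixRep_map_apply, ratRep_apply]

end MatrixRep

/-! ### Reindexing direct sums of representations. -/

section DirectSum

lemma directSum_equiv_congr {G k : Type} [Group G] [Field k] {ι κ : Type} [Finite ι] [Finite κ]
    (e : ι ≃ κ) {W : ι → Type} {W' : κ → Type} [∀ i, AddCommGroup (W i)] [∀ i, Module k (W i)]
    [∀ i, AddCommGroup (W' i)] [∀ i, Module k (W' i)] (ρ : ∀ i, Representation k G (W i))
    (ρ' : ∀ i, Representation k G (W' i)) (h : ∀ i, Nonempty ((ρ i).Equiv (ρ' (e i)))) :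
    Nonempty ((Representation.directSum ρ).Equiv (Representation.directSum ρ')) := by
  have := Fintype.ofFinite ι
  have := Fintype.ofFinite κ
  let f := fun i => (h i).some
  let d := DirectSum.linearEquivFunOnFintype k ι W
  let d' := DirectSum.linearEquivFunOnFintype k κ W'
  let c := (LinearEquiv.piCongrRight fun i => (f i).toLinearEquiv).trans
    (LinearEquiv.piCongrLeft k W' e)
  have hc : ∀ v i, c v (e i) = (f i).toLinearEquiv (v i) := fun v i =>
    Equiv.piCongrLeft_apply_apply W' e _ i
  refine ⟨Representation.Equiv.mk ((d.trans c).trans d'.symm) fun g => LinearMap.ext fun v => ?_⟩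
  refine d'.injective (funext fun j => ?_)
  obtain ⟨i, rfl⟩ := e.surjective j
  have h1 : ∀ y, d' (Representation.directSum ρ' g y) (e i) = ρ' (e i) g (d' y (e i)) := fun y => rfl
  have h2 : ∀ y, d (Representation.directSum ρ g y) i = ρ i g (d y i) := fun y => rfl
  simp only [LinearMap.comp_apply, LinearEquiv.coe_coe, LinearEquiv.trans_apply, h1,
    LinearEquiv.apply_symm_apply, hc]
  rw [h2]
  exact equiv_apply (f i) g _

end DirectSum

/-! ### Galois conjugates of characters. -/

section Lift

variable {H : Type} [Group H] {m : ℕ}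

/-- The Galois conjugate of a character with values in the cyclotomic field, as a complex
character. -/
def galChar (σ : cyclotomicSubfield m ≃ₐ[ℚ] cyclotomicSubfield m)
    (V : H →* (cyclotomicSubfield m)ˣ) : H →* ℂˣ :=
  (Units.map (embedding σ : cyclotomicSubfield m →* ℂ)).comp V

lemma galChar_apply (σ : cyclotomicSubfield m ≃ₐ[ℚ] cyclotomicSubfield m)
    (V : H →* (cyclotomicSubfield m)ˣ) (h : H) :
    ((galChar σ V h : ℂˣ) : ℂ) = (σ (V h : cyclotomicSubfield m) : ℂ) := rfl

lemma unitsMap_embedding_injective (σ : cyclotomicSubfield m ≃ₐ[ℚ] cyclotomicSubfield m) :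
    Function.Injective (Units.map (embedding σ : cyclotomicSubfield m →* ℂ)) :=
  Units.map_injective (embedding σ).injective

lemma ker_galChar (σ : cyclotomicSubfield m ≃ₐ[ℚ] cyclotomicSubfield m)
    (V : H →* (cyclotomicSubfield m)ˣ) : (galChar σ V).ker = V.ker := by
  ext h
  exact (map_eq_one_iff _ (unitsMap_embedding_injective σ))

lemma exists_galChar_one_eq (hm : m ≠ 0) {V : H →* ℂˣ} (hV : ∀ h, V h ^ m = 1) :
    ∃ V' : H →* (cyclotomicSubfield m)ˣ, galChar AlgEquiv.refl V' = V := by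
  have : NeZero m := ⟨hm⟩
  let f := Units.map (embedding (AlgEquiv.refl : cyclotomicSubfield m ≃ₐ[ℚ] cyclotomicSubfield m) :
    cyclotomicSubfield m →* ℂ)
  have hmem : ∀ h, V h ∈ f.range := by
    intro h
    have h1 : ((V h : ℂˣ) : ℂ) ^ m = 1 := by rw [← Units.val_pow_eq_pow_val, hV, Units.val_one]
    obtain ⟨a, -, ha⟩ := (Complex.isPrimitiveRoot_exp m hm).eq_pow_of_pow_eq_one h1
    have hu : IsUnit (cycloRoot m) := (isPrimitiveRoot_cycloRoot hm).isUnit hm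
    refine ⟨hu.unit ^ a, Units.ext ?_⟩
    rw [map_pow, Units.val_pow_eq_pow_val]
    exact ha
  let e := MonoidHom.ofInjective (f := f) (unitsMap_embedding_injective _)
  refine ⟨e.symm.toMonoidHom.comp (V.codRestrict f.range hmem), MonoidHom.ext fun h => ?_⟩
  exact congrArg Subtype.val (e.apply_symm_apply ⟨V h, hmem h⟩)

variable {V : H →* (cyclotomicSubfield m)ˣ}

lemma exists_apply_eq_cycloRoot (hm : m.Prime) (hV : ∀ h, V h ^ m = 1) (hV1 : V ≠ 1) :
    ∃ h, (V h : cyclotomicSubfield m) = cycloRoot m := by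
  have := Fact.mk hm
  have : NeZero m := ⟨hm.ne_zero⟩
  obtain ⟨h, hh⟩ : ∃ h, V h ≠ 1 := by
    by_contra! hcon
    exact hV1 (MonoidHom.ext hcon)
  have h1 : IsPrimitiveRoot (V h) m := IsPrimitiveRoot.iff_orderOf.2 (orderOf_eq_prime (hV h) hh)
  have h2 : IsPrimitiveRoot (V h : cyclotomicSubfield m) m := IsPrimitiveRoot.coe_units_iff.2 h1
  obtain ⟨a, -, ha⟩ := h2.eq_pow_of_pow_eq_one
    (isPrimitiveRoot_cycloRoot hm.ne_zero).pow_eq_one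
  exact ⟨h ^ a, by rw [map_pow, Units.val_pow_eq_pow_val, ha]⟩

lemma galChar_injective (hm : m.Prime) (hV : ∀ h, V h ^ m = 1) (hV1 : V ≠ 1) :
    Function.Injective fun σ => galChar σ V := by
  intro σ τ hστ
  have : NeZero m := ⟨hm.ne_zero⟩
  obtain ⟨h, hh⟩ := exists_apply_eq_cycloRoot hm hV hV1
  refine aut_ext (Subtype.ext ?_)
  rw [← hh, ← galChar_apply, ← galChar_apply]
  exact congrArg Units.val (DFunLike.congr_fun hστ h)

/-- The Galois group acts transitively on the characters with a given kernel. -/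
lemma exists_galChar_eq (hm : m.Prime) (hexp : ∀ h : H, h ^ m = 1) (hV1 : V ≠ 1) {U : H →* ℂˣ}
    (hU : U.ker = V.ker) : ∃ σ, U = galChar σ V := by
  have : NeZero m := ⟨hm.ne_zero⟩
  have := Fact.mk hm
  have hV : ∀ h, V h ^ m = 1 := fun h => by rw [← map_pow, hexp, map_one]
  have hVker := ker_galChar AlgEquiv.refl V
  have hne : galChar AlgEquiv.refl V ≠ 1 := fun e => by
    rw [e, MonoidHom.ker_one] at hVker
    exact hV1 (MonoidHom.ext fun h => MonoidHom.mem_ker.1 (hVker ▸ Subgroup.mem_top h))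
  obtain ⟨a, ha⟩ := exists_eq_pow_of_ker_eq hm hexp hne (hVker.trans hU.symm).le
  obtain ⟨h, hh⟩ := exists_apply_eq_cycloRoot hm hV hV1
  have hroot := isPrimitiveRoot_cycloRoot hm.ne_zero
  have hU1 : ∀ h, ((U h : ℂˣ) : ℂ) = (((V h : cyclotomicSubfield m) ^ a : cyclotomicSubfield m) : ℂ) :=
    fun h => by rw [ha]; rfl
  have hcop : (cycloRoot m) ^ a ≠ 1 := by
    intro e
    have h1 : U h = 1 := Units.ext (by rw [hU1, hh, e]; rfl)
    have h2 : V h = 1 := by rw [← MonoidHom.mem_ker, ← hU]; exact h1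
    rw [h2, Units.val_one] at hh
    exact hroot.ne_one hm.one_lt hh.symm
  -- U is the a-th power of V. Its value at an element where V is the primitive root is not 1, since
  -- the kernels agree, so it is again primitive and some automorphism reaches it.
  have hprim : IsPrimitiveRoot (cycloRoot m ^ a) m := IsPrimitiveRoot.iff_orderOf.2
    (orderOf_eq_prime (by rw [← pow_mul, mul_comm, pow_mul, hroot.pow_eq_one, one_pow]) hcop)
  obtain ⟨σ, hσ⟩ := exists_aut_apply_cycloRoot hprim
  refine ⟨σ, MonoidHom.ext fun h => Units.ext ?_⟩
  obtain ⟨b, -, hb⟩ := hroot.eq_pow_of_pow_eq_one (ξ := (V h : cyclotomicSubfield m)) (by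
    rw [← Units.val_pow_eq_pow_val, hV, Units.val_one])
  rw [hU1, galChar_apply, ← hb, map_pow, hσ, ← pow_mul, ← pow_mul, mul_comm]

end Lift

/-! ### Galois conjugates and rational irreducibility of induced representations. -/

section Induced

variable {G : Type} [Group G] {N : Subgroup G} [N.Normal] {m : ℕ}

lemma isFree_galChar {V : N →* (cyclotomicSubfield m)ˣ} (hV : IsFree V)
    (σ : cyclotomicSubfield m ≃ₐ[ℚ] cyclotomicSubfield m) : IsFree (galChar σ V) := by
  intro g hg
  refine hV g (MonoidHom.ext fun n => unitsMap_embedding_injective σ ?_)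
  exact DFunLike.congr_fun hg n

omit [N.Normal] in
lemma IsInducedFrom.of_equiv {k W W' : Type} [Field k] [AddCommGroup W] [Module k W]
    [AddCommGroup W'] [Module k W'] {ρ : Representation k G W} {ρ' : Representation k G W'}
    {V : N →* kˣ} {v : W} (h : IsInducedFrom ρ V v) (e : ρ.Equiv ρ') :
    IsInducedFrom ρ' V (e.toLinearEquiv v) where
  ne_zero h0 := h.ne_zero (e.toLinearEquiv.map_eq_zero_iff.1 h0)
  apply_eq n := by rw [← equiv_apply, h.apply_eq, map_smul]
  span_eq := by
    have h1 := congrArg (Submodule.map e.toLinearEquiv.toLinearMap) h.span_eq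
    rw [Submodule.map_span, Submodule.map_top, LinearEquiv.range, ← Set.range_comp] at h1
    rw [← h1]
    congr 2
    funext g
    exact (equiv_apply e g v).symm

lemma exists_isInducedFrom_matrixRep {k : Type} [Field k] [N.FiniteIndex] {V : N →* kˣ}
    (hV : IsFree V) : ∃ (A : G →* GL (Fin N.index) k) (v : Fin N.index → k),
      IsInducedFrom (matrixRep A) V v := by
  have h := isInducedFrom_ind V
  have : Finite (G ⧸ N) := inferInstance
  let b := (h.basis hV).reindex (Finite.equivFinOfCardEq (n := N.index) rfl)
  obtain ⟨A, ⟨e⟩⟩ := exists_matrixRep_equiv (Representation.ind N.subtype (charRep V)) b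
  exact ⟨A, _, h.of_equiv e⟩

/-- The entrywise map is only semilinear, so spanning is obtained from the dimension instead of
being transported. -/
lemma IsInducedFrom.galois [N.FiniteIndex] {n : ℕ} {A : G →* GL (Fin n) (cyclotomicSubfield m)}
    {V : N →* (cyclotomicSubfield m)ˣ} {v : Fin n → cyclotomicSubfield m}
    (h : IsInducedFrom (matrixRep A) V v) (hV : IsFree V)
    (σ : cyclotomicSubfield m ≃ₐ[ℚ] cyclotomicSubfield m) :
    IsInducedFrom (matrixRep ((Matrix.GeneralLinearGroup.map (embedding σ)).comp A)) (galChar σ V)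
      (embedding σ ∘ v) := by
  refine IsInducedFrom.of_finrank_eq (isFree_galChar hV σ) ?_ ?_ ?_
  · intro h0
    refine h.ne_zero (funext fun i => (embedding σ).injective ?_)
    rw [Pi.zero_apply, map_zero]
    exact congrFun h0 i
  · intro n
    rw [matrixRep_map_apply, h.apply_eq]
    funext i
    simp [galChar]
  · rw [← h.finrank_eq hV, Module.finrank_fin_fun, Module.finrank_fin_fun]

/-- The kernels of the conjugates of `V` under elements outside of `N` differ from the kernel
of `V`. -/
def IsKerFree {M : Type} [Group M] (V : N →* M) : Prop :=
  ∀ g : G, V.ker ≤ (conjHom g V).ker → g ∈ N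

lemma IsKerFree.eq_of_le {M : Type} [Group M] {V : N →* M} (hV : IsKerFree V) {x y : G ⧸ N}
    (h : (conjHom x.out V).ker ≤ (conjHom y.out V).ker) : x = y := by
  have h1 : V.ker ≤ (conjHom (x.out⁻¹ * y.out) V).ker := by
    intro n hn
    have h2 : MulAut.conjNormal x.out n ∈ (conjHom x.out V).ker := by
      rw [MonoidHom.mem_ker, conjHom_apply]
      simpa using hn
    have h3 := h h2
    rw [MonoidHom.mem_ker, conjHom_apply] at h3 ⊢
    rwa [mul_inv_rev, inv_inv, map_mul, MulAut.mul_apply]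
  have h2 := QuotientGroup.eq.2 (hV _ h1)
  rwa [QuotientGroup.out_eq', QuotientGroup.out_eq'] at h2

lemma IsKerFree.isFree {M : Type} [Group M] {V : N →* M} (hV : IsKerFree V) : IsFree V :=
  fun g hg => hV g (by rw [hg])

/-- The restriction of scalars to `ℚ` of an induced representation is irreducible. -/
lemma IsInducedFrom.isIrreducible_ratRep [NeZero m] [N.FiniteIndex] [Finite N] {d : ℕ}
    {A : G →* GL (Fin d) (cyclotomicSubfield m)} {V : N →* (cyclotomicSubfield m)ˣ}
    {v : Fin d → cyclotomicSubfield m} (h : IsInducedFrom (matrixRep A) V v) (hV : IsKerFree V)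
    (hroot : ∃ n, (V n : cyclotomicSubfield m) = cycloRoot m) : (ratRep A).IsIrreducible := by
  classical
  have := Fintype.ofFinite N
  have : Nontrivial (Fin d → cyclotomicSubfield m) := ⟨v, 0, h.ne_zero⟩
  refine isIrreducible_of_forall _ fun S w hw hw0 => ?_
  obtain ⟨x, hx⟩ := h.exists_repr_ne_zero hV.isFree hw0
  let H := (conjHom x.out V).ker
  -- S is only a ℚ-subspace, so the weights must be rational: the indicator of the kernel at `x`.
  -- The sum vanishes for `y ≠ x` because that kernel is not contained in the one at `y`.
  let f : N → cyclotomicSubfield m := fun n => if n ∈ H then 1 else 0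
  have hfsum : ∀ y : G ⧸ N, ∑ n, f n * (conjHom y.out V n : cyclotomicSubfield m) =
      ∑ n : H, (conjHom y.out V n : cyclotomicSubfield m) := fun y => by
    simp only [f, ite_mul, one_mul, zero_mul]
    rw [← Finset.sum_filter, Finset.sum_subtype (p := (· ∈ H)) _ (by simp)]
  have hf : ∀ y : G ⧸ N, y ≠ x → ∑ n, f n * (conjHom y.out V n : cyclotomicSubfield m) = 0 := by
    intro y hy
    rw [hfsum]
    let φ : H →* cyclotomicSubfield m :=
      (Units.coeHom (cyclotomicSubfield m)).comp ((conjHom y.out V).comp H.subtype)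
    refine sum_hom_units_eq_zero φ fun e => hy (hV.eq_of_le fun n hn => ?_).symm
    have h1 : φ ⟨n, hn⟩ = 1 := by rw [e]; rfl
    exact MonoidHom.mem_ker.2 (Units.ext h1)
  have hfx : ∑ n, f n * (conjHom x.out V n : cyclotomicSubfield m) = Fintype.card H := by
    rw [hfsum, Finset.sum_congr rfl fun n _ => by rw [MonoidHom.mem_ker.1 n.2, Units.val_one]]
    simp
  have hmem : ∑ n : N, f n • matrixRep A n w ∈ S.toSubmodule := sum_mem fun n _ => by
    by_cases hn : n ∈ H
    · simp only [f, if_pos hn, one_smul]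
      exact S.apply_mem_toSubmodule _ hw
    · simp only [f, if_neg hn, zero_smul]
      exact zero_mem _
  rw [h.sum_smul_apply hV.isFree f x hf, hfx] at hmem
  have hne : (h.basis hV.isFree).repr w x * (Fintype.card H : cyclotomicSubfield m) ≠ 0 :=
    mul_ne_zero hx (Nat.cast_ne_zero.2 Fintype.card_ne_zero)
  -- The coefficients with which the line of `x` meets S. They are stable under the primitive root,
  -- as the conjugate of `n0` by `x.out` acts on this line by `V n0`.
  let T : Submodule ℚ (cyclotomicSubfield m) := S.toSubmodule.comap
    ((LinearMap.toSpanSingleton (cyclotomicSubfield m) _ (matrixRep A x.out v)).restrictScalars ℚ)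
  have hT : ∀ a, a ∈ T ↔ a • matrixRep A x.out v ∈ S.toSubmodule := fun a => Iff.rfl
  obtain ⟨n0, hn0⟩ := hroot
  have hT' : ∀ a ∈ T, cycloRoot m * a ∈ T := fun a ha => by
    have h1 := S.apply_mem_toSubmodule (MulAut.conjNormal x.out n0 : N) ha
    have h2 : matrixRep A (MulAut.conjNormal x.out n0 : N) (a • matrixRep A x.out v) ∈
      S.toSubmodule := h1
    rw [map_smul, apply_apply_eq h.apply_eq, smul_smul, conjHom_apply, map_inv,
      MulAut.inv_apply_self, hn0, mul_comm] at h2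
    exact h2
  exact h.mem_of_apply_mem S.toSubmodule (fun g w hw => S.apply_mem_toSubmodule g hw) (y := x.out)
    fun c => mem_of_cycloRoot_mul_mem T hT' hmem hne c

end Induced

/-! ### Descent of intertwiners from ℂ to ℚ. -/

section Descent

variable {G : Type} [Group G]

/-- Two irreducible rational representations with a non-zero homomorphism between their
complexifications are equivalent. -/
lemma nonempty_equiv_of_complexify {Y W : Type} [AddCommGroup Y] [Module ℚ Y] [AddCommGroup W]
    [Module ℚ W] {ρ : Representation ℚ G Y} {ρ' : Representation ℚ G W} (hρ : ρ.IsIrreducible)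
    (hρ' : ρ'.IsIrreducible) (f : TensorProduct ℚ ℂ Y →ₗ[ℂ] TensorProduct ℚ ℂ W)
    (hf : ∀ g t, f (complexify ρ g t) = complexify ρ' g (f t)) {t : TensorProduct ℚ ℂ Y}
    (ht : f t ≠ 0) : Nonempty (ρ.Equiv ρ') := by
  classical
  obtain ⟨y, hy⟩ : ∃ y, f (1 ⊗ₜ y) ≠ 0 := by
    by_contra! hcon
    refine ht ?_
    have : f = 0 := TensorProduct.AlgebraTensorModule.ext fun z y => by
      have h1 : (z ⊗ₜ[ℚ] y : TensorProduct ℚ ℂ Y) = z • (1 ⊗ₜ y) := by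
        rw [TensorProduct.smul_tmul', smul_eq_mul, mul_one]
      rw [h1, map_smul, hcon, smul_zero, LinearMap.zero_apply]
    rw [this, LinearMap.zero_apply]
  -- A ℚ-basis of ℂ splits ℂ ⊗ W into copies of W compatibly with G, so a non-zero coordinate of `f`
  -- is a rational intertwiner.
  let b := Module.Basis.ofVectorSpace ℚ ℂ
  let E := TensorProduct.equivFinsuppOfBasisLeft (N := W) b
  obtain ⟨i, hi⟩ : ∃ i, E (f (1 ⊗ₜ y)) i ≠ 0 := by
    by_contra! hcon
    exact hy (E.map_eq_zero_iff.1 (Finsupp.ext hcon))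
  let f0 : Y →ₗ[ℚ] W := Finsupp.lapply i ∘ₗ E.toLinearMap ∘ₗ f.restrictScalars ℚ ∘ₗ
    TensorProduct.mk ℚ ℂ Y 1
  have hE : ∀ g t, E (complexify ρ' g t) i = ρ' g (E t i) := by
    intro g t
    induction t using TensorProduct.induction_on with
    | zero => simp
    | add a b ha hb => simp only [map_add, Finsupp.add_apply, ha, hb]
    | tmul z w =>
      rw [complexify_tmul, TensorProduct.equivFinsuppOfBasisLeft_apply_tmul_apply,
        TensorProduct.equivFinsuppOfBasisLeft_apply_tmul_apply, map_smul]
  refine nonempty_equiv_of_ne_zero hρ hρ' f0 (fun g w => ?_) (w := y) hi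
  have h1 : f0 (ρ g w) = E (f (complexify ρ g (1 ⊗ₜ w))) i := rfl
  rw [h1, hf, hE]
  rfl

/-- A homomorphism from a summand extends to the direct sum. -/
lemma exists_hom_of_directSum {k : Type} [Field k] {ι Y Z : Type} {X : ι → Type}
    [AddCommGroup Y] [Module k Y] [AddCommGroup Z] [Module k Z] [∀ i, AddCommGroup (X i)]
    [∀ i, Module k (X i)] {ρ : Representation k G Y} {τ : Representation k G Z}
    {θ : ∀ i, Representation k G (X i)} (e : ρ.Equiv (Representation.directSum θ)) {i : ι}
    (f : X i →ₗ[k] Z) (hf : ∀ g x, f (θ i g x) = τ g (f x)) {x : X i} (hx : f x ≠ 0) :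
    ∃ F : Y →ₗ[k] Z, (∀ g y, F (ρ g y) = τ g (F y)) ∧ ∃ y, F y ≠ 0 := by
  classical
  obtain ⟨E, hE⟩ : ∃ E : Y ≃ₗ[k] DirectSum ι X,
      ∀ g y, E (ρ g y) = Representation.directSum θ g (E y) := ⟨e.toLinearEquiv, equiv_apply e⟩
  refine ⟨f ∘ₗ DirectSum.component k ι X i ∘ₗ E.toLinearMap, fun g y => ?_,
    E.symm (DirectSum.of X i x), ?_⟩
  · simp only [LinearMap.comp_apply, LinearEquiv.coe_coe, hE]
    rw [← hf]
    rfl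
  · simp only [LinearMap.comp_apply, LinearEquiv.coe_coe, LinearEquiv.apply_symm_apply]
    have : DirectSum.component k ι X i (DirectSum.of X i x) = x := DirectSum.of_eq_same i x
    rwa [this]

end Descent

/-! ### Construction of the rational representations. -/

section Rational

variable {G : Type} [Group G] {N : Subgroup G} [N.Normal] {p q m : ℕ}

lemma isKerFree_of_galChar {V : N →* (cyclotomicSubfield m)ˣ}
    {σ : cyclotomicSubfield m ≃ₐ[ℚ] cyclotomicSubfield m} (hV : IsKerFree (galChar σ V)) :
    IsKerFree V := fun g hg => hV g (by
  rwa [ker_conjHom, ker_galChar, ← ker_conjHom])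

/-- The rational representation attached to a character of prime order. -/
lemma exists_ratRep [N.FiniteIndex] [Finite N] (hm : m.Prime) {V : N →* ℂˣ}
    (hVm : ∀ n, V n ^ m = 1) (hV1 : V ≠ 1) (hV : IsKerFree V) :
    ∃ (A : G →* GL (Fin N.index) (cyclotomicSubfield m)) (V' : N →* (cyclotomicSubfield m)ˣ)
      (v : Fin N.index → cyclotomicSubfield m), galChar AlgEquiv.refl V' = V ∧
      IsInducedFrom (matrixRep A) V' v ∧ IsKerFree V' ∧ V' ≠ 1 ∧ (∀ n, V' n ^ m = 1) ∧
      (ratRep A).IsIrreducible := by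
  have : NeZero m := ⟨hm.ne_zero⟩
  obtain ⟨V', rfl⟩ := exists_galChar_one_eq hm.ne_zero hVm
  have hV' := isKerFree_of_galChar hV
  obtain ⟨A, v, h⟩ := exists_isInducedFrom_matrixRep hV'.isFree
  have h1 : V' ≠ 1 := by
    rintro rfl
    exact hV1 (MonoidHom.ext fun n => Units.ext (by rw [galChar_apply]; simp))
  have h2 : ∀ n, V' n ^ m = 1 := fun n => by
    refine unitsMap_embedding_injective AlgEquiv.refl ?_
    rw [map_pow, map_one]
    exact hVm n
  exact ⟨A, V', v, rfl, h, hV', h1, h2, h.isIrreducible_ratRep hV'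
    (exists_apply_eq_cycloRoot hm h2 h1)⟩

/-- The degenerate case N = G, which lets the construction of the U_j produce U as well. -/
lemma isInducedFrom_charRep {k : Type} [Field k] (ψ : G →* kˣ) :
    IsInducedFrom (N := (⊤ : Subgroup G)) (charRep ψ) (ψ.comp (⊤ : Subgroup G).subtype) 1 where
  ne_zero := one_ne_zero
  apply_eq _ := rfl
  span_eq := by
    rw [eq_top_iff]
    intro a _
    have h1 : charRep ψ 1 1 = 1 := by simp
    have h2 : (1 : k) ∈ Submodule.span k (Set.range fun g => charRep ψ g 1) :=
      Submodule.subset_span ⟨1, h1⟩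
    simpa using Submodule.smul_mem _ a h2

lemma pow_index_mem (hN : N.index = p) (g : G) : g ^ p ∈ N := by
  rw [← hN, Subgroup.index_eq_card, ← QuotientGroup.eq_one_iff, QuotientGroup.mk_pow,
    pow_card_eq_one']

/-- The rational representation whose complexification is the sum of the non-trivial characters of a
quotient of prime order. -/
lemma exists_ratRep_charRep [Finite G] (hp : p.Prime) (hN : N.index = p)
    {χ : Fin p → (G →* ℂˣ)} {i0 : Fin p} (hχ0 : χ i0 = 1) (hχ : Function.Injective χ)
    (hχr : Set.range χ = {ψ | N ≤ ψ.ker}) :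
    ∃ A : G →* GL (Fin (⊤ : Subgroup G).index) (cyclotomicSubfield p),
      (ratRep A).IsIrreducible ∧ Nonempty ((complexify (ratRep A)).Equiv
        (Representation.directSum fun i : {i : Fin p // i ≠ i0} => charRep (χ i))) := by
  have : NeZero p := ⟨hp.ne_zero⟩
  have hcard : Nat.card {i : Fin p // i ≠ i0} = p - 1 := by
    rw [Nat.card_eq_fintype_card, Fintype.card_subtype_compl, Fintype.card_subtype_eq,
      Fintype.card_fin]
  obtain ⟨⟨i1, hi1⟩⟩ : Nonempty {i : Fin p // i ≠ i0} :=
    (Nat.card_ne_zero.1 (by rw [hcard]; exact (Nat.sub_pos_of_lt hp.one_lt).ne')).1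
  have hker : ∀ i, N ≤ (χ i).ker := fun i => by
    have : χ i ∈ {ψ : G →* ℂˣ | N ≤ ψ.ker} := hχr ▸ Set.mem_range_self i
    exact this
  have hne : (χ i1).comp (⊤ : Subgroup G).subtype ≠ 1 := fun e => hi1 (hχ (by
    rw [hχ0]
    exact MonoidHom.ext fun g => DFunLike.congr_fun e (⟨g, trivial⟩ : (⊤ : Subgroup G))))
  obtain ⟨A, V, v, hV, h, hVf, hV1, hVp, hirr⟩ := exists_ratRep (N := (⊤ : Subgroup G)) hp
    (V := (χ i1).comp (⊤ : Subgroup G).subtype)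
    (fun g => by
      rw [← map_pow]
      exact hker i1 (pow_index_mem hN (g : G))) hne fun _ _ => trivial
  let ψ : (cyclotomicSubfield p ≃ₐ[ℚ] cyclotomicSubfield p) → (G →* ℂˣ) := fun σ =>
    (galChar σ V).comp (Subgroup.topEquiv (G := G)).symm.toMonoidHom
  have hψ : ∀ σ, (ψ σ).comp (⊤ : Subgroup G).subtype = galChar σ V := fun σ => rfl
  have hψker : ∀ σ g, ψ σ g = 1 ↔ χ i1 g = 1 := by
    intro σ g
    have h1 : (⟨g, trivial⟩ : (⊤ : Subgroup G)) ∈ (galChar σ V).ker ↔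
        (⟨g, trivial⟩ : (⊤ : Subgroup G)) ∈ ((χ i1).comp (⊤ : Subgroup G).subtype).ker := by
      rw [← hV, ker_galChar, ker_galChar]
    exact h1
  have hex : ∀ σ, ∃ i : {i : Fin p // i ≠ i0}, χ i = ψ σ := by
    intro σ
    obtain ⟨i, hi⟩ : ψ σ ∈ Set.range χ := by
      rw [hχr]
      exact fun n hn => (hψker σ n).2 (hker i1 hn)
    refine ⟨⟨i, ?_⟩, hi⟩
    rintro rfl
    refine hi1 (hχ (hχ0 ▸ MonoidHom.ext fun g => (hψker σ g).1 ?_))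
    rw [← hi, hχ0]
    rfl
  choose f hf using hex
  have hfinj : Function.Injective f := fun σ τ e => galChar_injective hp hVp hV1 (by
    change galChar σ V = galChar τ V
    rw [← hψ σ, ← hψ τ, ← hf, ← hf, e])
  -- The p - 1 Galois conjugates are distinct and lie among the p - 1 non-trivial χ_i, so they
  -- exhaust them.
  have hbij : Function.Bijective f := hfinj.bijective_of_nat_card_le (by
    rw [hcard, IsGalois.card_aut_eq_finrank, finrank_cyclotomicSubfield hp])
  refine ⟨A, hirr, ?_⟩
  obtain ⟨e⟩ := complexify_ratRep_equiv hp A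
  obtain ⟨e'⟩ := directSum_equiv_congr (Equiv.ofBijective f hbij)
    (fun σ => matrixRep ((Matrix.GeneralLinearGroup.map (embedding σ)).comp A))
    (fun i => charRep (χ i)) fun σ => by
      have h1 := isInducedFrom_charRep (ψ σ)
      rw [hψ] at h1
      rw [Equiv.ofBijective_apply, hf]
      exact (h.galois hVf.isFree σ).exists_equiv (isFree_galChar hVf.isFree σ) h1
  exact ⟨e.trans e'⟩

lemma trivial_isIrreducible {k : Type} [Field k] :
    (Representation.trivial k G k).IsIrreducible := by
  refine isIrreducible_of_forall _ fun S w hw hw0 v => ?_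
  have : (v / w) • w ∈ S.toSubmodule := S.toSubmodule.smul_mem _ hw
  rwa [smul_eq_mul, div_mul_cancel₀ _ hw0] at this

lemma finrank_ratRep (hm : m.Prime) (n : ℕ) :
    Module.finrank ℚ (Fin n → cyclotomicSubfield m) = n * (m - 1) := by
  have : NeZero m := ⟨hm.ne_zero⟩
  rw [Module.finrank_pi_fintype]
  simp [finrank_cyclotomicSubfield hm]

lemma nonempty_equiv_trivial {W : Type} [AddCommGroup W] [Module ℚ W] {ρ : Representation ℚ G W}
    (hρ : ρ.IsIrreducible) {w : TensorProduct ℚ ℂ W} (hw : w ≠ 0)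
    (h : ∀ g, complexify ρ g w = w) : Nonempty (ρ.Equiv (Representation.trivial ℚ G ℚ)) := by
  let f : TensorProduct ℚ ℂ ℚ →ₗ[ℂ] TensorProduct ℚ ℂ W :=
    LinearMap.toSpanSingleton ℂ _ w ∘ₗ (TensorProduct.AlgebraTensorModule.rid ℚ ℂ ℂ).toLinearMap
  obtain ⟨e⟩ := nonempty_equiv_of_complexify trivial_isIrreducible hρ f (fun g t => by
    have h1 : complexify (Representation.trivial ℚ G ℚ) g t = t := by
      induction t using TensorProduct.induction_on with
      | zero => simp
      | add a b ha hb => rw [map_add, ha, hb]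
      | tmul z w => rfl
    rw [h1]
    simp only [f, LinearMap.comp_apply, LinearMap.toSpanSingleton_apply, map_smul, h])
    (t := 1 ⊗ₜ 1) (by simpa [f] using hw)
  exact ⟨e.symm⟩

lemma isGaloisConj_indChar [N.FiniteIndex] {n : ℕ} {A : G →* GL (Fin n) (cyclotomicSubfield m)}
    {V : N →* (cyclotomicSubfield m)ˣ} {v : Fin n → cyclotomicSubfield m}
    (h : IsInducedFrom (matrixRep A) V v) (hV : IsFree V)
    (σ : cyclotomicSubfield m ≃ₐ[ℚ] cyclotomicSubfield m) :
    IsGaloisConj σ (indChar (galChar AlgEquiv.refl V))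
      (Rep.of (matrixRep ((Matrix.GeneralLinearGroup.map (embedding σ)).comp A))) :=
  ⟨n, A, (isInducedFrom_ind _).exists_equiv (isFree_galChar hV _) (h.galois hV AlgEquiv.refl),
    ⟨Representation.Equiv.refl _⟩⟩

end Rational

/-! ### The complete list of rational irreducible representations. -/

section RationalList

variable {G : Type} [Group G] {N : Subgroup G} [N.Normal] {p q : ℕ}

lemma eq_of_isCoatom_of_le {X : Type} [PartialOrder X] [OrderTop X] {a b : X} (ha : IsCoatom a)
    (hb : IsCoatom b) (h : a ≤ b) : a = b :=
  (ha.le_iff.1 h).resolve_left hb.1 |>.symm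

lemma isKerFree_of_ne_one (hp : p.Prime) (hN : N.index = p) (hq : q.Prime)
    (hcop : Nat.Coprime p (q - 1)) (hc : ∀ a b : N, a * b = b * a) (hexp : ∀ n : N, n ^ q = 1)
    (hfree : ∀ V : N →* ℂˣ, V ≠ 1 → IsFree V) {V : N →* ℂˣ} (hV : V ≠ 1) : IsKerFree V :=
  fun _ hg => mem_of_ker_conjHom_eq hp hN hq hcop hc hexp hfree hV
    (eq_of_isCoatom_of_le (isCoatom_ker hq hexp hV)
      (isCoatom_ker hq hexp fun h => hV (conjHom_eq_one_iff.1 h)) hg).symm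

theorem exists_isCompleteIrrepList_rational [Finite N] (hp : p.Prime) (hp3 : 3 ≤ p)
    (hN : N.index = p) (hq : q.Prime) (hcop : Nat.Coprime p (q - 1))
    (hc : ∀ a b : N, a * b = b * a) (hexp : ∀ n : N, n ^ q = 1)
    (hfree : ∀ V : N →* ℂˣ, V ≠ 1 → IsFree V) {χ : Fin p → (G →* ℂˣ)} {i0 : Fin p}
    (hχ0 : χ i0 = 1) (hχ : Function.Injective χ) (hχr : Set.range χ = {ψ | N ≤ ψ.ker})
    {ι : Type} {L : ι → Subgroup N} (hL : IsMaximalOrbitReps L) {V : ι → (N →* ℂˣ)}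
    (hVL : ∀ j, (V j).ker = L j) :
    ∃ (U : Rep.{0} ℚ G) (Us : ι → Rep.{0} ℚ G),
      Module.finrank ℚ U = p - 1 ∧
      Nonempty ((complexify U.ρ).Equiv
        (Representation.directSum fun i : {i : Fin p // i ≠ i0} => charRep (χ i))) ∧
      (∀ j, Module.finrank ℚ (Us j) = p * (q - 1) ∧
        ∃ R : (cyclotomicSubfield q ≃ₐ[ℚ] cyclotomicSubfield q) → Rep.{0} ℂ G,
          (∀ σ, IsGaloisConj σ (indChar (V j)) (R σ)) ∧
          Nonempty ((complexify (Us j).ρ).Equiv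
            (Representation.directSum fun σ => (R σ).ρ))) ∧
      IsCompleteIrrepList
        (Sum.elim (fun _ : Unit => Rep.of (Representation.trivial ℚ G ℚ))
          (Sum.elim (fun _ : Unit => U) Us)) := by
  have : N.FiniteIndex := ⟨by rw [hN]; exact hp.ne_zero⟩
  have : Finite G := Nat.finite_of_card_ne_zero (by
    rw [← N.card_mul_index, hN]
    exact mul_ne_zero Nat.card_pos.ne' hp.ne_zero)
  have hV1 : ∀ j, V j ≠ 1 := fun j => ne_one_of_isCoatom_ker ((hVL j).symm ▸ hL.1 j)
  have hVf : ∀ j, IsKerFree (V j) := fun j =>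
    isKerFree_of_ne_one hp hN hq hcop hc hexp hfree (hV1 j)
  choose A V' v hV' h hV'f hV'1 hV'q hirr using fun j =>
    exists_ratRep hq (map_pow_eq_one hexp (V j)) (hV1 j) (hVf j)
  have hker : ∀ j, (V' j).ker = L j := fun j => by rw [← hVL, ← hV' j, ker_galChar]
  obtain ⟨A0, hirr0, ⟨e0⟩⟩ := exists_ratRep_charRep hp hN hχ0 hχ hχr
  have hd0 : Module.finrank ℚ (Fin (⊤ : Subgroup G).index → cyclotomicSubfield p) = p - 1 := by
    rw [finrank_ratRep hp, Subgroup.index_top, one_mul]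
  have hd : Module.finrank ℚ (Fin N.index → cyclotomicSubfield q) = p * (q - 1) := by
    rw [finrank_ratRep hq, hN]
  -- The degrees 1 < p - 1 < p(q - 1) separate the three kinds; the first inequality needs p ≥ 3.
  have hlt : p - 1 < p * (q - 1) :=
    lt_of_lt_of_le (Nat.sub_lt hp.pos one_pos) (Nat.le_mul_of_pos_right p (Nat.sub_pos_of_lt hq.one_lt))
  refine ⟨Rep.of (ratRep A0), fun j => Rep.of (ratRep (A j)), hd0, ⟨e0⟩, fun j => ⟨hd,
    fun σ => Rep.of (matrixRep ((Matrix.GeneralLinearGroup.map (embedding σ)).comp (A j))),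
    fun σ => ?_, complexify_ratRep_equiv hq (A j)⟩, ?_, ?_, ?_⟩
  · have := isGaloisConj_indChar (h j) (hV'f j).isFree σ
    rwa [hV' j] at this
  · rintro (_ | _ | j)
    · exact trivial_isIrreducible
    · exact hirr0
    · exact hirr j
  · have h01 : ¬ Nonempty ((Representation.trivial ℚ G ℚ).Equiv (ratRep A0)) := fun ⟨e⟩ => by
      have := e.toLinearEquiv.finrank_eq
      rw [hd0, Module.finrank_self] at this
      omega
    have h02 : ∀ j, ¬ Nonempty ((Representation.trivial ℚ G ℚ).Equiv (ratRep (A j))) :=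
      fun j ⟨e⟩ => by
        have := e.toLinearEquiv.finrank_eq
        rw [hd, Module.finrank_self] at this
        omega
    have h12 : ∀ j, ¬ Nonempty ((ratRep A0).Equiv (ratRep (A j))) := fun j ⟨e⟩ => by
      have := e.toLinearEquiv.finrank_eq
      rw [hd, hd0] at this
      omega
    rintro (_ | _ | i) (_ | _ | j) ⟨e⟩
    · rfl
    · exact absurd ⟨e⟩ h01
    · exact absurd ⟨e⟩ (h02 j)
    · exact absurd ⟨e.symm⟩ h01
    · rfl
    · exact absurd ⟨e⟩ (h12 j)
    · exact absurd ⟨e.symm⟩ (h02 i)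
    · exact absurd ⟨e.symm⟩ (h12 i)
    · obtain ⟨E, hE⟩ : ∃ E : (Fin N.index → cyclotomicSubfield q) ≃ₗ[ℚ]
          (Fin N.index → cyclotomicSubfield q), ∀ g w, E (ratRep (A i) g w) = ratRep (A j) g (E w) :=
        ⟨e.toLinearEquiv, equiv_apply e⟩
      -- E is only ℚ-linear, but it preserves the property of being fixed by `L i`; so `L i` lies in
      -- a conjugate of `L j`, and both are maximal.
      obtain ⟨g, hg⟩ := (h j).exists_le_ker_conjHom (hV'f j).isFree (w := E (v i))
        (fun h0 => (h i).ne_zero (E.map_eq_zero_iff.1 h0)) (H := L i) fun n hn => by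
          rw [← ratRep_apply, ← hE, ratRep_apply, (h i).apply_eq,
            MonoidHom.mem_ker.1 (hker i ▸ hn : n ∈ (V' i).ker), Units.val_one, one_smul]
      rw [ker_conjHom, hker] at hg
      have hco : IsCoatom ((L j).map (MulAut.conjNormal g : MulAut N).toMonoidHom) :=
        ((MulAut.conjNormal g : MulAut N).mapSubgroup.isCoatom_iff _).2 (hL.1 j)
      refine congrArg (Sum.inr ∘ Sum.inr) ((hL.2 (L i) (hL.1 i)).unique ⟨1, ?_⟩
        ⟨g, eq_of_isCoatom_of_le (hL.1 i) hco hg⟩)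
      rw [map_one]
      exact (Subgroup.map_id _).symm
  · intro W _ _ ρ hρ
    have := nontrivial_of_isIrreducible hρ
    rcases exists_eigenvector hp hN hc (complexify ρ) with ⟨ψ, w, hψ, hw, hψw⟩ | ⟨X, w, hX, hw, hXw⟩
    · obtain ⟨i, rfl⟩ : ψ ∈ Set.range χ := hχr ▸ hψ
      by_cases hi : i = i0
      · refine ⟨Sum.inl (), nonempty_equiv_trivial hρ hw fun g => ?_⟩
        rw [hψw, hi, hχ0, MonoidHom.one_apply, Units.val_one, one_smul]
      · obtain ⟨F, hF, t, ht⟩ := exists_hom_of_directSum e0 (i := ⟨i, hi⟩) (τ := complexify ρ)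
          (LinearMap.toSpanSingleton ℂ _ w) (fun g a => by
            simp only [LinearMap.toSpanSingleton_apply, charRep_apply, map_smul, hψw, smul_smul]
            rw [mul_comm]) (x := 1) (by simpa using hw)
        obtain ⟨e⟩ := nonempty_equiv_of_complexify hirr0 hρ F hF ht
        exact ⟨Sum.inr (Sum.inl ()), ⟨e.symm⟩⟩
    · obtain ⟨j, ⟨g, hg⟩, -⟩ := hL.2 X.ker (isCoatom_ker hq hexp hX)
      -- The conjugate of X with kernel exactly `L j` is a Galois conjugate of `V' j`, so the
      -- summand of the complexified U_j at that σ maps non-trivially to ρ.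
      have hXg : X = conjHom g (conjHom g⁻¹ X) := by
        rw [← conjHom_mul, mul_inv_cancel, conjHom_one]
      have hkerX : (conjHom g⁻¹ X).ker = (V' j).ker := by
        rw [ker_conjHom, hg, Subgroup.map_map, hker]
        convert Subgroup.map_id (L j) using 2
        ext n
        simp
      obtain ⟨σ, hσ⟩ := exists_galChar_eq hq hexp (hV'1 j) hkerX
      have hw' := apply_inv_eq_of_conjHom hXg hXw
      rw [hσ] at hw'
      obtain ⟨f, hf, hfv⟩ := ((h j).galois (hV'f j).isFree σ).exists_hom
        (isFree_galChar (hV'f j).isFree σ) hw'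
      obtain ⟨e1⟩ := complexify_ratRep_equiv hq (A j)
      obtain ⟨F, hF, t, ht⟩ := exists_hom_of_directSum e1 (i := σ) (τ := complexify ρ) f hf
        (x := embedding σ ∘ v j) (by rw [hfv]; exact apply_ne_zero _ hw _)
      obtain ⟨e⟩ := nonempty_equiv_of_complexify (hirr j) hρ F hF ht
      exact ⟨Sum.inr (Sum.inr j), ⟨e.symm⟩⟩

/-- The linear characters of `G` which are trivial on a normal subgroup of prime index. -/
lemma exists_charactersOfQuotient (hp : p.Prime) (hN : N.index = p) (i0 : Fin p) :
    ∃ χ : Fin p → (G →* ℂˣ), χ i0 = 1 ∧ Function.Injective χ ∧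
      Set.range χ = {ψ | N ≤ ψ.ker} := by
  classical
  have hcard : Nat.card (G ⧸ N) = p := hN
  have : Finite (G ⧸ N) := Nat.finite_of_card_ne_zero (by rw [hcard]; exact hp.ne_zero)
  have := Fact.mk hp
  have : IsCyclic (G ⧸ N) := isCyclic_of_prime_card hcard
  let _ : CommGroup (G ⧸ N) := IsCyclic.commGroup
  have hcard' : Nat.card ((G ⧸ N) →* ℂˣ) = p := by
    rw [CommGroup.card_monoidHom_of_hasEnoughRootsOfUnity, hcard]
  have : Finite ((G ⧸ N) →* ℂˣ) :=
    Nat.finite_of_card_ne_zero (by rw [hcard']; exact hp.ne_zero)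
  let e := (Finite.equivFinOfCardEq hcard').symm
  -- The swap places the trivial character at the index `i0`.
  let e' := (Equiv.swap i0 (e.symm 1)).trans e
  have he' : e' i0 = 1 := by simp [e']
  refine ⟨fun i => (e' i).comp (QuotientGroup.mk' N), ?_, fun i j hij => e'.injective ?_, ?_⟩
  · simp only [he']
    rfl
  · exact (MonoidHom.cancel_right (QuotientGroup.mk'_surjective N)).1 hij
  · ext ψ
    constructor
    · rintro ⟨i, rfl⟩ n hn
      rw [MonoidHom.mem_ker, MonoidHom.comp_apply, QuotientGroup.mk'_apply,
        (QuotientGroup.eq_one_iff n).2 hn, map_one]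
    · intro hψ
      refine ⟨e'.symm (QuotientGroup.lift N ψ hψ), ?_⟩
      simp only [Equiv.apply_symm_apply]
      rfl

end RationalList

lemma dvd_pow_mul_sub_one {p q s : ℕ} (hp : p.Prime) (hq : q.Prime) (hpq : p ≠ q) :
    p ∣ q ^ ((p - 1) * s) - 1 := by
  have h1 : q ^ (p - 1) ≡ 1 [MOD p] := by
    rw [← Nat.totient_prime hp]
    exact Nat.ModEq.pow_totient ((Nat.coprime_primes hq hp).2 hpq.symm)
  have h2 := h1.pow s
  rw [one_pow, ← pow_mul] at h2
  exact (Nat.modEq_iff_dvd' (Nat.one_le_pow _ _ hq.pos)).1 h2.symm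

end PGonal

end

theorem mainTheorem5 (p q r : ℕ) (hp : p.Prime) (hp3 : 3 ≤ p) (hq : q.Prime) (hpq : p ≠ q)
    (hr : 3 ≤ r) (hg : 4 ≤ (p - 1) * (r - 2))
    (Γ : Subgroup (PGonal.FuchsianGroup p r)) [Γ.Normal] (hΓ : PGonal.IsSurfaceKernel p r Γ) :
    p ∣ q ^ ((p - 1) * (r - 2)) - 1 ∧
    ∃ χ : Fin p → (PGonal.LiftGroup Γ q →* ℂˣ),
      χ ⟨0, hp.pos⟩ = 1 ∧ Function.Injective χ ∧
      Set.range χ = {ψ | PGonal.homologyGroup Γ q ≤ ψ.ker} ∧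
      -- the complex irreducible representations
      (∃ V : Fin ((q ^ ((p - 1) * (r - 2)) - 1) / p) → (PGonal.homologyGroup Γ q →* ℂˣ),
        PGonal.IsCharOrbitReps V) ∧
      (∀ V : Fin ((q ^ ((p - 1) * (r - 2)) - 1) / p) → (PGonal.homologyGroup Γ q →* ℂˣ),
        PGonal.IsCharOrbitReps V →
          (∀ j, Module.finrank ℂ (PGonal.indChar (V j)) = p) ∧
          PGonal.IsCompleteIrrepList
            (Sum.elim (fun i => Rep.of (PGonal.charRep (χ i))) fun j => PGonal.indChar (V j))) ∧
      -- the rational irreducible representations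
      (Nat.Coprime p (q - 1) →
      p * (q - 1) ∣ q ^ ((p - 1) * (r - 2)) - 1 ∧
      (∃ L : Fin ((q ^ ((p - 1) * (r - 2)) - 1) / (p * (q - 1))) →
          Subgroup (PGonal.homologyGroup Γ q), PGonal.IsMaximalOrbitReps L) ∧
      ∀ L : Fin ((q ^ ((p - 1) * (r - 2)) - 1) / (p * (q - 1))) →
          Subgroup (PGonal.homologyGroup Γ q), PGonal.IsMaximalOrbitReps L →
        (∀ j, ∃ V : PGonal.homologyGroup Γ q →* ℂˣ, V.ker = L j) ∧
        ∀ V : Fin ((q ^ ((p - 1) * (r - 2)) - 1) / (p * (q - 1))) →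
            (PGonal.homologyGroup Γ q →* ℂˣ), (∀ j, (V j).ker = L j) →
          ∃ (U : Rep.{0} ℚ (PGonal.LiftGroup Γ q))
            (Us : Fin ((q ^ ((p - 1) * (r - 2)) - 1) / (p * (q - 1))) →
              Rep.{0} ℚ (PGonal.LiftGroup Γ q)),
            Module.finrank ℚ U = p - 1 ∧
            Nonempty ((PGonal.complexify U.ρ).Equiv
              (Representation.directSum
                fun i : {i : Fin p // i ≠ ⟨0, hp.pos⟩} => PGonal.charRep (χ i))) ∧
            (∀ j, Module.finrank ℚ (Us j) = p * (q - 1) ∧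
              ∃ R : (PGonal.cyclotomicSubfield q ≃ₐ[ℚ] PGonal.cyclotomicSubfield q) →
                  Rep.{0} ℂ (PGonal.LiftGroup Γ q),
                (∀ σ, PGonal.IsGaloisConj σ (PGonal.indChar (V j)) (R σ)) ∧
                Nonempty ((PGonal.complexify (Us j).ρ).Equiv
                  (Representation.directSum fun σ => (R σ).ρ))) ∧
            PGonal.IsCompleteIrrepList
              (Sum.elim
                (fun _ : Unit => Rep.of (Representation.trivial ℚ (PGonal.LiftGroup Γ q) ℚ))
                (Sum.elim (fun _ : Unit => U) Us))) := by
  obtain ⟨s, rfl⟩ : ∃ s, r = s + 2 := ⟨r - 2, by omega⟩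
  have H := PGonal.isEllipticSystem_liftGen hp hq hpq hΓ
  have hcard : Nat.card (PGonal.homologyGroup Γ q →* ℂˣ) = q ^ ((p - 1) * (s + 2 - 2)) :=
    PGonal.card_homologyGroup_dual hp hq hpq hΓ
  have : Finite (PGonal.homologyGroup Γ q) := H.finite
  have hpos : 1 ≤ q ^ ((p - 1) * (s + 2 - 2)) := Nat.one_le_pow _ _ hq.pos
  have : Finite (PGonal.homologyGroup Γ q →* ℂˣ) :=
    Nat.finite_of_card_ne_zero (by rw [hcard]; exact (pow_pos hq.pos _).ne')
  have hfree : ∀ V : PGonal.homologyGroup Γ q →* ℂˣ, V ≠ 1 → PGonal.IsFree V :=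
    fun V hV g hg => H.mem_of_conjHom_eq hV hg
  have hdvd := PGonal.dvd_pow_mul_sub_one (s := s + 2 - 2) hp hq hpq
  obtain ⟨χ, hχ0, hχ, hχr⟩ := PGonal.exists_charactersOfQuotient hp H.index_eq ⟨0, hp.pos⟩
  refine ⟨hdvd, χ, hχ0, hχ, hχr, ?_, fun V hV => ⟨fun j => ?_, ?_⟩, fun hcop => ?_⟩
  · refine PGonal.exists_charOrbitReps hp H.index_eq H.comm hfree ?_
    rw [hcard, Nat.div_mul_cancel hdvd, Nat.sub_add_cancel hpos]
  · have : (PGonal.homologyGroup Γ q).FiniteIndex := ⟨by rw [H.index_eq]; exact hp.ne_zero⟩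
    rw [PGonal.IsInducedFrom.finrank_indChar (hfree _ (hV.1 j)), H.index_eq]
  · exact PGonal.isCompleteIrrepList_complex hp H.index_eq H.comm hfree hχ hχr hV
  · have hdvd' : p * (q - 1) ∣ q ^ ((p - 1) * (s + 2 - 2)) - 1 :=
      hcop.mul_dvd_of_dvd_of_dvd hdvd (by simpa using Nat.sub_dvd_pow_sub_pow q 1 ((p - 1) * (s + 2 - 2)))
    refine ⟨hdvd', ?_, fun L hL => ⟨fun j => PGonal.exists_ker_eq H.comm (hL.1 j), fun V hVL => ?_⟩⟩
    · refine PGonal.exists_maximalOrbitReps hp H.index_eq hq hcop H.comm H.pow_q hfree ?_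
      rw [hcard, Nat.div_mul_cancel hdvd', Nat.sub_add_cancel hpos]
    · exact PGonal.exists_isCompleteIrrepList_rational hp hp3 H.index_eq hq hcop H.comm H.pow_q hfree hχ0
        hχ hχr hL hVL
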